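/- Let $(X,d)$ be a compact metric space and $f:X\to X$ a continuous map. Let $\mathcal M(f)$ be the set of $f$-invariant Borel probability measures on $X$ with the weak-$*$ topology, and let $C(X)$ be the space of continuous functions $X\to\mathbb R$ with the supremum norm. For $\mu\in\mathcal M(f)$ let $h_\mu(f)\in[0,\infty]$ be the metric (Kolmogorov–Sinai) entropy, and for $\phi\in C(X)$ put $P_\mu(\phi)=h_\mu(f)+\int\phi\,d\mu$. Let $P(\phi)$ be the topological pressure of $(X,f,\phi)$ and let $\mathcal E(\phi)=\{\mu\in\mathcal M(f): P_\mu(\phi)=P(\phi)\}$ be the set of equilibrium states of $\phi$. Assume that the entropy map $\mu\mapsto h_\mu(f)$ is upper semi-continuous on $\mathcal M(f)$. (1) Let $\psi\in C(X)$, and let $\mathcal V(f,\psi)$ be the set of all $\phi\in C(X)$ such that $P_\mu(\psi)$ has the same value, denoted $P^\psi(\phi)$, for all $\mu\in\mathcal E(\phi)$. Then the function $\phi\mapsto P^\psi(\phi)$ is continuous on $\mathcal V(f,\psi)$ with respect to the supremum norm. (2) In particular, let $\mathcal U(f)$ be the set of all $\phi\in C(X)$ that have exactly one equilibrium state, denoted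 $\mu_\phi$. Then $\phi\mapsto h_{\mu_\phi}(f)$ is continuous on $\mathcal U(f)$ with respect to the supremum norm. (Should entropies be infinite, continuity is meant for functions with values in $[-\infty,\infty]$; for finite values this is ordinary continuity.) -/

import Mathlib

open MeasureTheory Filter Topology
open scoped ENNReal

namespace Thermo

noncomputable section

/-! Metric entropy of a map with respect to a probability measure. -/

section Entropy

variable {X : Type*} [MeasurableSpace X]

/-- Shannon entropy `H_μ(η) = -∑ₐ μ(Aₐ) log μ(Aₐ)` of the finite partition of `X` into the
fibres `Aₐ = η ⁻¹ {a}` of a labelling map `η` (empty fibres contribute `0`). -/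
def partitionEntropy {ι : Type*} [Fintype ι] (μ : Measure X) (η : X → ι) : ℝ :=
  ∑ a, Real.negMulLog (μ.real (η ⁻¹' {a}))

/-- The labelling map of the joined partition `ξ ∨ f⁻¹ξ ∨ ⋯ ∨ f⁻⁽ⁿ⁻¹⁾ξ`. -/
def itinerary {ι : Type*} (f : X → X) (ξ : X → ι) (n : ℕ) (x : X) : Fin n → ι :=
  fun i => ξ (f^[i] x)

/-- `h_μ(f, ξ) = lim (1/n) H_μ(ξ ∨ f⁻¹ξ ∨ ⋯ ∨ f⁻⁽ⁿ⁻¹⁾ξ)`; the limit exists when `μ` is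
`f`-invariant, by subadditivity, so it is written as an upper limit. -/
def entropyOfPartition {ι : Type*} [Fintype ι] (f : X → X) (μ : Measure X) (ξ : X → ι) : ℝ≥0∞ :=
  limsup (fun n : ℕ => ENNReal.ofReal (partitionEntropy μ (itinerary f ξ n) / n)) atTop

/-- Kolmogorov-Sinai entropy `h_μ(f) ∈ [0, ∞]`: the supremum of `h_μ(f, ξ)` over all finite
measurable partitions `ξ`, given by their measurable labelling maps `X → Fin k`. -/
def metricEntropy (f : X → X) (μ : ProbabilityMeasure X) : ℝ≥0∞ :=
  ⨆ (k : ℕ) (ξ : X → Fin k) (_ : Measurable ξ), entropyOfPartition f (μ : Measure X) ξ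

/-- The set `M(f)` of `f`-invariant probability measures. -/
def invariantMeasures (f : X → X) : Set (ProbabilityMeasure X) :=
  {μ | MeasurePreserving f (μ : Measure X) (μ : Measure X)}

end Entropy

/-! Topological pressure, through separated sets. -/

section Pressure

variable {X : Type*} [MetricSpace X]

/-- `E` is `(n, ε)`-separated: distinct points of `E` are at distance more than `ε` in the
metric `d_n(x, y) = max_{0 ≤ k < n} d(f^k x, f^k y)`. -/
def IsSeparatedSet (f : X → X) (n : ℕ) (ε : ℝ) (E : Finset X) : Prop :=
  ∀ x ∈ E, ∀ y ∈ E, x ≠ y → ∃ k < n, ε < dist (f^[k] x) (f^[k] y)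

/-- The supremum over `(n, ε)`-separated sets `E` of `∑_{x ∈ E} exp (S_n φ (x))`, with
`S_n φ = ∑_{k < n} φ ∘ f^k`. (If `X` is compact and `f` is continuous, every
`(n, ε)`-separated set is finite.) -/
def separatedSum (f : X → X) (φ : C(X, ℝ)) (n : ℕ) (ε : ℝ) : ℝ≥0∞ :=
  ⨆ (E : Finset X) (_ : IsSeparatedSet f n ε E),
    ∑ x ∈ E, ENNReal.ofReal (Real.exp (birkhoffSum f φ n x))

/-- The topological pressure
`P(f, φ) = lim_{ε → 0} limsup_{n → ∞} (1/n) log sup_E ∑_{x ∈ E} exp (S_n φ (x))`.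
The upper limit increases as `ε` decreases, so the limit is a supremum over `ε > 0`. -/
def topPressure (f : X → X) (φ : C(X, ℝ)) : EReal :=
  ⨆ (ε : ℝ) (_ : 0 < ε), limsup (fun n : ℕ => ENNReal.log (separatedSum f φ n ε) / (n : EReal)) atTop

end Pressure

section Equilibrium

variable {X : Type*} [MetricSpace X] [MeasurableSpace X]

/-- `(X, f)` is a USC system: `μ ↦ h_μ(f)` is upper semi-continuous on `M(f)` with the
weak-* topology. -/
def IsUSC [BorelSpace X] (f : X → X) : Prop :=
  UpperSemicontinuousOn (metricEntropy f) (invariantMeasures f)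

/-- The pressure `P_μ(φ) = h_μ(f) + ∫ φ dμ ∈ (-∞, ∞]` of `μ`. -/
def measurePressure (f : X → X) (μ : ProbabilityMeasure X) (φ : C(X, ℝ)) : EReal :=
  (metricEntropy f μ : EReal) + ((∫ x, φ x ∂(μ : Measure X) : ℝ) : EReal)

/-- The set of equilibrium states of `(X, f, φ)`. -/
def equilibriumStates (f : X → X) (φ : C(X, ℝ)) : Set (ProbabilityMeasure X) :=
  {μ | μ ∈ invariantMeasures f ∧ measurePressure f μ φ = topPressure f φ}

/-- `V(f, ψ)`: the potentials `φ` such that `P_μ(ψ)` is constant over the equilibrium states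
`μ` of `φ`. -/
def constPressureSet (f : X → X) (ψ : C(X, ℝ)) : Set C(X, ℝ) :=
  {φ | ∃ c : EReal, ∀ μ ∈ equilibriumStates f φ, measurePressure f μ ψ = c}

/-- `P^ψ(φ)`: the common value of `P_μ(ψ)` for the equilibrium states `μ` of `φ ∈ V(f, ψ)`. -/
def commonPressure (f : X → X) (ψ : C(X, ℝ)) (φ : constPressureSet f ψ) : EReal :=
  φ.2.choose

theorem measurePressure_eq_commonPressure (f : X → X) (ψ : C(X, ℝ)) (φ : constPressureSet f ψ)
    (μ : ProbabilityMeasure X) (hμ : μ ∈ equilibriumStates f φ) :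
    measurePressure f μ ψ = commonPressure f ψ φ :=
  φ.2.choose_spec μ hμ

/-- `U(f)`: the potentials with a unique equilibrium state. -/
def uniqueEquilibriumSet (f : X → X) : Set C(X, ℝ) :=
  {φ | ∃! μ, μ ∈ equilibriumStates f φ}

/-- The unique equilibrium state `μ_φ` of `φ ∈ U(f)`. -/
def uniqueEquilibriumState (f : X → X) (φ : uniqueEquilibriumSet f) : ProbabilityMeasure X :=
  φ.2.choose

theorem mem_equilibriumStates_iff (f : X → X) (φ : uniqueEquilibriumSet f)
    (μ : ProbabilityMeasure X) :
    μ ∈ equilibriumStates f φ ↔ μ = uniqueEquilibriumState f φ :=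
  ⟨fun h => φ.2.choose_spec.2 μ h, fun h => by rw [h]; exact φ.2.choose_spec.1⟩

end Equilibrium

end

end Thermo

namespace Thermo

/-! Let `φ i → φ₀` uniformly along an ultrafilter and let `ν i` be an equilibrium state of `φ i`.
Invariant measures form a weak-* compact set, so `ν i → μ` with `μ` invariant. Maximality of `ν i`
against `μ` gives `h_μ + ∫ φ i dμ - ∫ φ i dν i ≤ h_{ν i}`, and the two integrals have the same
limit, so entropy cannot jump up at `μ`; upper semi-continuity says it cannot drop. Hence the
entropies converge, and so do the pressures of every `ψ`. Passing to the limit in the maximality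
against an equilibrium state of `φ₀` shows that `μ` is itself one, so the limit is the common value
at `φ₀` (`exists_equilibriumState_tendsto`). Entropy alone is the case `ψ = 0`.

Equilibrium states are defined through the topological pressure of separated sets, so their
maximality and existence rest on the variational principle, proved here in full after Misiurewicz.
The upper bound `measurePressure_le_topPressure` compares a partition with disjoint closed sets,
counts itineraries with a spanning separated set, and removes the constant error by passing to
iterates. The lower bound `exists_le_measurePressure` takes weak-* limits of averaged Gibbs measures
on separated sets. -/

theorem itinerary_add_eq_iff {X A : Type*} {f : X → X} {ξ : X → A} {m n : ℕ} {x y : X} :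
    itinerary f ξ (m + n) x = itinerary f ξ (m + n) y ↔
      itinerary f ξ m x = itinerary f ξ m y ∧
        itinerary f ξ n (f^[m] x) = itinerary f ξ n (f^[m] y) := by
  simp only [funext_iff, itinerary, ← Function.iterate_add_apply]
  constructor
  · intro h
    exact ⟨fun i => h (Fin.castAdd n i), fun i => by
      simpa [add_comm] using h (Fin.natAdd m i)⟩
  · rintro ⟨h1, h2⟩ i
    refine Fin.addCases (fun j => h1 j) (fun j => ?_) i
    simpa [add_comm] using h2 j

theorem itinerary_succ_eq_iff {X A : Type*} {f : X → X} {ξ : X → A} {n : ℕ} {x y : X} :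
    itinerary f ξ (n + 1) x = itinerary f ξ (n + 1) y ↔
      itinerary f ξ n x = itinerary f ξ n y ∧ ξ (f^[n] x) = ξ (f^[n] y) := by
  rw [itinerary_add_eq_iff]
  simp [funext_iff, itinerary]

theorem itinerary_factorsThrough {X A : Type*} {f : X → X} {ξ : X → A} {m n : ℕ} (h : m ≤ n) :
    (itinerary f ξ m).FactorsThrough (itinerary f ξ n) := by
  obtain ⟨k, rfl⟩ := Nat.exists_eq_add_of_le h
  intro x y h
  exact (itinerary_add_eq_iff.1 h).1

/-! ### Shannon entropy of finite partitions. -/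

section FiniteEntropy

variable {X : Type*} [MeasurableSpace X] {A B C : Type*}

/-- The fibres of the labelling map `α` are measurable. -/
def MeasurableFibers (α : X → A) : Prop := ∀ a, MeasurableSet (α ⁻¹' {a})

theorem MeasurableFibers.preimage [Finite A] {α : X → A} (hα : MeasurableFibers α) (s : Set A) :
    MeasurableSet (α ⁻¹' s) := by
  rw [← Set.biUnion_preimage_singleton]
  exact s.toFinite.measurableSet_biUnion fun a _ => hα a

theorem MeasurableFibers.comp [Finite A] {α : X → A} (hα : MeasurableFibers α) (g : A → B) :
    MeasurableFibers (g ∘ α) := fun b => hα.preimage (g ⁻¹' {b})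

theorem MeasurableFibers.comp_measurable {α : X → A} (hα : MeasurableFibers α) {f : X → X}
    (hf : Measurable f) : MeasurableFibers (α ∘ f) := fun a => hf (hα a)

theorem MeasurableFibers.prodMk {α : X → A} {β : X → B} (hα : MeasurableFibers α)
    (hβ : MeasurableFibers β) : MeasurableFibers (fun x => (α x, β x)) := by
  rintro ⟨a, b⟩
  convert (hα a).inter (hβ b) using 1
  ext x
  simp

theorem MeasurableFibers.itinerary {α : X → A} (hα : MeasurableFibers α) {f : X → X}
    (hf : Measurable f) (n : ℕ) : MeasurableFibers (itinerary f α n) := by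
  intro c
  have : Thermo.itinerary f α n ⁻¹' {c} = ⋂ i : Fin n, f^[i] ⁻¹' (α ⁻¹' {c i}) := by
    ext x
    simp [Thermo.itinerary, funext_iff]
  rw [this]
  exact MeasurableSet.iInter fun i => (hf.iterate i) (hα _)

theorem _root_.Measurable.measurableFibers [MeasurableSpace A] [MeasurableSingletonClass A]
    {α : X → A} (hα : Measurable α) : MeasurableFibers α := fun a => hα (measurableSet_singleton a)

/-- Gibbs' inequality. -/
theorem sum_negMulLog_le_of_sum_le {ι : Type*} (s : Finset ι) (p q : ι → ℝ)
    (hp : ∀ i ∈ s, 0 ≤ p i) (hq : ∀ i ∈ s, 0 ≤ q i) (hpq : ∀ i ∈ s, q i = 0 → p i = 0)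
    (hsum : ∑ i ∈ s, q i ≤ ∑ i ∈ s, p i) :
    ∑ i ∈ s, Real.negMulLog (p i) ≤ ∑ i ∈ s, -(p i * Real.log (q i)) := by
  -- This is `log t ≤ t - 1` at `t = q i / p i`; the corrections `q i - p i` have nonpositive sum.
  have key : ∀ i ∈ s, Real.negMulLog (p i) ≤ -(p i * Real.log (q i)) + (q i - p i) := by
    intro i hi
    rcases (hp i hi).eq_or_lt with h | h
    · simpa [← h] using hq i hi
    · have hq' : 0 < q i := lt_of_le_of_ne (hq i hi) fun h0 => h.ne' (hpq i hi h0.symm)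
      have h1 := Real.log_le_sub_one_of_pos (div_pos hq' h)
      rw [Real.log_div hq'.ne' h.ne'] at h1
      have h2 := mul_le_mul_of_nonneg_left h1 h.le
      have h3 : p i * (q i / p i - 1) = q i - p i := by field_simp
      rw [Real.negMulLog]
      linarith
  have := Finset.sum_le_sum key
  rw [Finset.sum_add_distrib, Finset.sum_sub_distrib] at this
  linarith

variable [Fintype A] [Fintype B] [Fintype C] (μ : Measure X)

theorem partitionEntropy_eq (α : X → A) :
    partitionEntropy μ α = -∑ a, μ.real (α ⁻¹' {a}) * Real.log (μ.real (α ⁻¹' {a})) := by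
  simp [partitionEntropy, Real.negMulLog]

theorem partitionEntropy_comp_measurePreserving {α : X → A} (hα : MeasurableFibers α)
    {f : X → X} (hf : MeasurePreserving f μ μ) :
    partitionEntropy μ (α ∘ f) = partitionEntropy μ α := by
  refine Finset.sum_congr rfl fun a _ => ?_
  rw [Set.preimage_comp, hf.measureReal_preimage (hα a).nullMeasurableSet]

variable [IsProbabilityMeasure μ]

theorem sum_real_mul_comp {α : X → A} (hα : MeasurableFibers α) (g : A → B) (F : B → ℝ) :
    ∑ a, μ.real (α ⁻¹' {a}) * F (g a) = ∑ b, μ.real ((g ∘ α) ⁻¹' {b}) * F b := by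
  classical
  have h : ∀ b, μ.real ((g ∘ α) ⁻¹' {b}) = ∑ a with g a = b, μ.real (α ⁻¹' {a}) := by
    intro b
    rw [sum_measureReal_preimage_singleton _ (fun a _ => hα a)]
    congr 1
    ext x
    simp
  simp_rw [h, Finset.sum_mul]
  rw [← Finset.sum_fiberwise (s := Finset.univ) (g := g)]
  refine Finset.sum_congr rfl fun b _ => Finset.sum_congr rfl fun a ha => ?_
  rw [(Finset.mem_filter.1 ha).2]

theorem sum_real_fibers {α : X → A} (hα : MeasurableFibers α) :
    ∑ a, μ.real (α ⁻¹' {a}) = 1 := by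
  rw [sum_measureReal_preimage_singleton _ (fun a _ => hα a)]
  simp

theorem partitionEntropy_nonneg (α : X → A) : 0 ≤ partitionEntropy μ α :=
  Finset.sum_nonneg fun _ _ => Real.negMulLog_nonneg measureReal_nonneg measureReal_le_one

/-- Each fibre of `α` lies in a fibre of `g ∘ α`, so once both sums are indexed by the finer labels
the logarithms compare term by term. -/
theorem partitionEntropy_comp_le {α : X → A} (hα : MeasurableFibers α) (g : A → B) :
    partitionEntropy μ (g ∘ α) ≤ partitionEntropy μ α := by
  rw [partitionEntropy_eq, partitionEntropy_eq, neg_le_neg_iff,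
    ← sum_real_mul_comp μ hα g fun b => Real.log (μ.real ((g ∘ α) ⁻¹' {b}))]
  refine Finset.sum_le_sum fun a _ => ?_
  rcases (measureReal_nonneg (μ := μ) (s := α ⁻¹' {a})).eq_or_lt with h | h
  · simp [← h]
  · refine mul_le_mul_of_nonneg_left (Real.log_le_log h (measureReal_mono ?_)) h.le
    intro x hx
    simp_all

theorem partitionEntropy_mono {α : X → A} {β : X → B} (hβ : MeasurableFibers β)
    (h : α.FactorsThrough β) : partitionEntropy μ α ≤ partitionEntropy μ β := by
  obtain ⟨x⟩ : Nonempty X := nonempty_of_isProbabilityMeasure μ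
  have : Nonempty A := ⟨α x⟩
  obtain ⟨g, rfl⟩ := (Function.factorsThrough_iff α).1 h
  exact partitionEntropy_comp_le μ hβ g

theorem partitionEntropy_congr {α : X → A} {β : X → B} (hα : MeasurableFibers α)
    (hβ : MeasurableFibers β) (h : ∀ x y, α x = α y ↔ β x = β y) :
    partitionEntropy μ α = partitionEntropy μ β :=
  le_antisymm (partitionEntropy_mono μ hβ fun x y => (h x y).2)
    (partitionEntropy_mono μ hα fun x y => (h x y).1)

/-- Submodularity of Shannon entropy. -/
theorem partitionEntropy_submodular {α : X → A} {β : X → B} {γ : X → C} (hα : MeasurableFibers α)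
    (hβ : MeasurableFibers β) (hγ : MeasurableFibers γ) :
    partitionEntropy μ (fun x => (α x, β x, γ x)) + partitionEntropy μ γ ≤
      partitionEntropy μ (fun x => (α x, γ x)) + partitionEntropy μ (fun x => (β x, γ x)) := by
  set τ : X → A × B × C := fun x => (α x, β x, γ x) with hτdef
  have hτ : MeasurableFibers τ := hα.prodMk (hβ.prodMk hγ)
  set p : A × B × C → ℝ := fun t => μ.real (τ ⁻¹' {t})
  set pac : A × C → ℝ := fun t => μ.real ((fun x => (α x, γ x)) ⁻¹' {t})
  set pbc : B × C → ℝ := fun t => μ.real ((fun x => (β x, γ x)) ⁻¹' {t})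
  set pc : C → ℝ := fun t => μ.real (γ ⁻¹' {t})
  have hac : ∀ t, p t ≤ pac (t.1, t.2.2) := fun t => measureReal_mono fun x hx => by
    simp only [Set.mem_preimage, Set.mem_singleton_iff] at hx ⊢; rw [← hx]
  have hbc : ∀ t, p t ≤ pbc t.2 := fun t => measureReal_mono fun x hx => by
    simp only [Set.mem_preimage, Set.mem_singleton_iff] at hx ⊢; rw [← hx]
  have hc : ∀ t, p t ≤ pc t.2.2 := fun t => measureReal_mono fun x hx => by
    simp only [Set.mem_preimage, Set.mem_singleton_iff] at hx ⊢; rw [← hx]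
  have hp0 : ∀ t, 0 ≤ p t := fun t => measureReal_nonneg
  have hsac : ∀ c, ∑ a, pac (a, c) = pc c := by
    intro c
    classical
    have := sum_real_mul_comp μ (hα.prodMk hγ) Prod.snd (fun c' => if c' = c then 1 else 0)
    simpa [Fintype.sum_prod_type, Function.comp_def] using this
  have hsbc : ∀ c, ∑ b, pbc (b, c) = pc c := by
    intro c
    classical
    have := sum_real_mul_comp μ (hβ.prodMk hγ) Prod.snd (fun c' => if c' = c then 1 else 0)
    simpa [Fintype.sum_prod_type, Function.comp_def] using this
  -- Gibbs' inequality against the law making `α` and `β` conditionally independent given `γ`. Where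
  -- `pc` vanishes the quotient is `0` by convention, and so is `p`.
  have hG := sum_negMulLog_le_of_sum_le Finset.univ p
    (fun t => pac (t.1, t.2.2) * pbc t.2 / pc t.2.2) (fun t _ => hp0 t)
    (fun t _ => by positivity)
    (fun t _ h => by
      rcases div_eq_zero_iff.1 h with h | h
      · rcases mul_eq_zero.1 h with h | h
        · exact le_antisymm (h ▸ hac t) (hp0 t)
        · exact le_antisymm (h ▸ hbc t) (hp0 t)
      · exact le_antisymm (h ▸ hc t) (hp0 t))
    (by
      rw [show ∑ t, p t = 1 from sum_real_fibers μ hτ, ← sum_real_fibers μ hγ]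
      apply le_of_eq
      calc ∑ t : A × B × C, pac (t.1, t.2.2) * pbc t.2 / pc t.2.2
          = ∑ c, (∑ a, pac (a, c)) * (∑ b, pbc (b, c)) / pc c := by
            simp_rw [Finset.sum_mul_sum, Finset.sum_div, Fintype.sum_prod_type]
            rw [Finset.sum_comm (s := (Finset.univ : Finset C))]
            exact Finset.sum_congr rfl fun a _ => Finset.sum_comm
        _ = ∑ c, pc c := Finset.sum_congr rfl fun c _ => by
            rw [hsac, hsbc]
            exact mul_self_div_self _)
  have hlog : ∑ t, -(p t * Real.log (pac (t.1, t.2.2) * pbc t.2 / pc t.2.2)) =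
      -∑ t, p t * Real.log (pac (t.1, t.2.2)) - ∑ t, p t * Real.log (pbc t.2)
        + ∑ t, p t * Real.log (pc t.2.2) := by
    rw [← Finset.sum_neg_distrib, ← Finset.sum_sub_distrib, ← Finset.sum_add_distrib]
    refine Finset.sum_congr rfl fun t _ => ?_
    rcases (hp0 t).eq_or_lt with h | h
    · simp [← h]
    · have h1 := h.trans_le (hac t)
      have h2 := h.trans_le (hbc t)
      have h3 := h.trans_le (hc t)
      rw [Real.log_div (by positivity) h3.ne', Real.log_mul h1.ne' h2.ne']
      ring
  have e1 := sum_real_mul_comp μ hτ (fun t => (t.1, t.2.2)) (fun t => Real.log (pac t))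
  have e2 := sum_real_mul_comp μ hτ (fun t => t.2) (fun t => Real.log (pbc t))
  have e3 := sum_real_mul_comp μ hτ (fun t => t.2.2) (fun t => Real.log (pc t))
  rw [hlog, show ∑ t, p t * Real.log (pac (t.1, t.2.2)) = _ from e1,
    show ∑ t, p t * Real.log (pbc t.2) = _ from e2,
    show ∑ t, p t * Real.log (pc t.2.2) = _ from e3] at hG
  rw [partitionEntropy_eq μ γ, partitionEntropy_eq μ (fun x => (α x, γ x)),
    partitionEntropy_eq μ (fun x => (β x, γ x))]
  change partitionEntropy μ τ ≤ -(∑ t, pac t * Real.log (pac t)) -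
    (∑ t, pbc t * Real.log (pbc t)) + ∑ t, pc t * Real.log (pc t) at hG
  change partitionEntropy μ τ + -(∑ t, pc t * Real.log (pc t)) ≤
    -(∑ t, pac t * Real.log (pac t)) + -(∑ t, pbc t * Real.log (pbc t))
  linarith

theorem partitionEntropy_const (a : A) : partitionEntropy μ (fun _ => a) = 0 := by
  classical
  refine Finset.sum_eq_zero fun b _ => ?_
  by_cases h : a = b
  · simp [h]
  · simp [Set.preimage_const_of_notMem (show a ∉ ({b} : Set A) from h)]

/-- Subadditivity of Shannon entropy. -/
theorem partitionEntropy_prodMk_le {α : X → A} {β : X → B} (hα : MeasurableFibers α)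
    (hβ : MeasurableFibers β) :
    partitionEntropy μ (fun x => (α x, β x)) ≤ partitionEntropy μ α + partitionEntropy μ β := by
  have hu : MeasurableFibers (fun _ : X => ()) := fun a => by simp
  have h := partitionEntropy_submodular μ hα hβ hu
  rw [partitionEntropy_const, add_zero] at h
  refine (partitionEntropy_mono μ (hα.prodMk (hβ.prodMk hu)) ?_).trans (h.trans (add_le_add
    (partitionEntropy_mono μ hα ?_) (partitionEntropy_mono μ hβ ?_)))
  · intro x y h
    simp_all
  · intro x y h
    simp_all
  · intro x y h
    simp_all

/-- Gibbs' inequality against the uniform weights. -/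
theorem partitionEntropy_le_log_card {α : X → A} (hα : MeasurableFibers α) :
    partitionEntropy μ α ≤ Real.log (Fintype.card A) := by
  obtain ⟨x⟩ : Nonempty X := nonempty_of_isProbabilityMeasure μ
  have : Nonempty A := ⟨α x⟩
  have hc : (0 : ℝ) < Fintype.card A := by exact_mod_cast Fintype.card_pos
  have := sum_negMulLog_le_of_sum_le Finset.univ (fun a => μ.real (α ⁻¹' {a}))
    (fun _ => (Fintype.card A : ℝ)⁻¹) (fun _ _ => measureReal_nonneg) (fun _ _ => by positivity)
    (fun _ _ h => absurd h (by positivity)) (by rw [sum_real_fibers μ hα]; simp [hc.ne'])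
  refine this.trans_eq ?_
  rw [Finset.sum_neg_distrib, ← Finset.sum_mul, sum_real_fibers μ hα, Real.log_inv]
  ring

/-- `H(ξⁿ ∨ ηⁿ) - H(ηⁿ) ≤ n (H(ξ ∨ η) - H(η))`. -/
theorem partitionEntropy_itinerary_cond_le {ξ : X → A} {η : X → B} (hξ : MeasurableFibers ξ)
    (hη : MeasurableFibers η) {f : X → X} (hf : MeasurePreserving f μ μ) (n : ℕ) :
    partitionEntropy μ (fun x => (itinerary f ξ n x, itinerary f η n x)) -
        partitionEntropy μ (itinerary f η n) ≤
      n * (partitionEntropy μ (fun x => (ξ x, η x)) - partitionEntropy μ η) := by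
  induction n with
  | zero =>
    have h : partitionEntropy μ (fun x => (itinerary f ξ 0 x, itinerary f η 0 x)) ≤
        partitionEntropy μ (itinerary f η 0) :=
      partitionEntropy_mono μ (hη.itinerary hf.measurable 0) fun x y h =>
        Prod.ext (Subsingleton.elim _ _) h
    simpa using h
  | succ n ih =>
    have hm := hf.measurable
    have hA := hξ.itinerary hm n
    have hB := hη.itinerary hm n
    have ha := hξ.comp_measurable (hm.iterate n)
    have hb := hη.comp_measurable (hm.iterate n)
    -- With `A, B` the first `n` symbols and `a, b` the next ones, these say `H(A,a|B,b) ≤ H(A|B,b)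
    -- + H(a|B,b)`, `H(A|B,b) ≤ H(A|B)` and `H(a|B,b) ≤ H(a|b)`; the last bound equals `H(ξ|η)` by
    -- invariance.
    have s1 := partitionEntropy_submodular μ hA ha (hB.prodMk hb)
    have s2 := partitionEntropy_submodular μ hA hb hB
    have s3 := partitionEntropy_submodular μ ha hB hb
    have i1 : partitionEntropy μ (fun x => ((ξ ∘ f^[n]) x, (η ∘ f^[n]) x)) =
        partitionEntropy μ (fun x => (ξ x, η x)) :=
      partitionEntropy_comp_measurePreserving μ (hξ.prodMk hη) (hf.iterate n)
    have i2 := partitionEntropy_comp_measurePreserving μ hη (hf.iterate n)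
    have c1 : partitionEntropy μ (fun x => (itinerary f ξ (n + 1) x, itinerary f η (n + 1) x)) ≤
        partitionEntropy μ (fun x => (itinerary f ξ n x, (ξ ∘ f^[n]) x, itinerary f η n x,
          (η ∘ f^[n]) x)) := by
      refine partitionEntropy_mono μ (hA.prodMk (ha.prodMk (hB.prodMk hb))) fun x y h => ?_
      simp only [Prod.mk.injEq, Function.comp_apply] at h
      exact Prod.ext (itinerary_succ_eq_iff.2 ⟨h.1, h.2.1⟩) (itinerary_succ_eq_iff.2 h.2.2)
    have c2 : partitionEntropy μ (fun x => (itinerary f η n x, (η ∘ f^[n]) x)) =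
        partitionEntropy μ (itinerary f η (n + 1)) :=
      partitionEntropy_congr μ (hB.prodMk hb) (hη.itinerary hm _) fun x y => by
        rw [itinerary_succ_eq_iff]; simp
    have c3 : partitionEntropy μ (fun x => ((η ∘ f^[n]) x, itinerary f η n x)) =
        partitionEntropy μ (itinerary f η (n + 1)) :=
      partitionEntropy_congr μ (hb.prodMk hB) (hη.itinerary hm _) fun x y => by
        rw [itinerary_succ_eq_iff]; simp [and_comm]
    have c4 : partitionEntropy μ (fun x => (itinerary f ξ n x, itinerary f η n x,
          (η ∘ f^[n]) x)) =
        partitionEntropy μ (fun x => (itinerary f ξ n x, (η ∘ f^[n]) x, itinerary f η n x)) :=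
      partitionEntropy_congr μ (hA.prodMk (hB.prodMk hb)) (hA.prodMk (hb.prodMk hB)) fun x y => by
        simp only [Prod.mk.injEq]; tauto
    push_cast
    linarith

end FiniteEntropy

/-! ### Separated sets and pressure. -/

section Separated

variable {X : Type*} [MetricSpace X]

/-- The Birkhoff sum of a continuous function along a continuous map. -/
def birkhoffMap {f : X → X} (hf : Continuous f) (φ : C(X, ℝ)) (n : ℕ) : C(X, ℝ) :=
  ∑ k ∈ Finset.range n, φ.comp ⟨f^[k], hf.iterate k⟩

theorem coe_birkhoffMap {f : X → X} (hf : Continuous f) (φ : C(X, ℝ)) (n : ℕ) :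
    ⇑(birkhoffMap hf φ n) = birkhoffSum f φ n := by
  ext x
  simp [birkhoffMap, birkhoffSum]

theorem birkhoffSum_iterate {α : Type*} (f : α → α) (φ : α → ℝ) (N n : ℕ) :
    birkhoffSum f^[N] (birkhoffSum f φ N) n = birkhoffSum f φ (N * n) := by
  induction n with
  | zero => ext; simp
  | succ n ih =>
    ext x
    rw [birkhoffSum_succ, ih, Nat.mul_succ, birkhoffSum_add, ← Function.iterate_mul]

/-- Separation by `f^[N]` at time `k` is separation by `f` at time `N * k`. Thus sums for the
iterate are bounded by the pressure of `f`, and the pressure of the iterate is never needed. -/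
theorem IsSeparatedSet.of_iterate {f : X → X} {N n : ℕ} {ε : ℝ} {E : Finset X} (hN : 0 < N)
    (hE : IsSeparatedSet f^[N] n ε E) : IsSeparatedSet f (N * n) ε E := by
  intro x hx y hy hxy
  obtain ⟨k, hk, h⟩ := hE x hx y hy hxy
  refine ⟨N * k, Nat.mul_lt_mul_of_pos_left hk hN, ?_⟩
  rwa [Function.iterate_mul]

/-- In a compact space there is a separated set which is also spanning. -/
theorem exists_isSeparatedSet_spanning [CompactSpace X] {f : X → X} (hf : Continuous f) (n : ℕ)
    {ε : ℝ} (hε : 0 < ε) :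
    ∃ E : Finset X, IsSeparatedSet f n ε E ∧
      ∀ x, ∃ y ∈ E, ∀ k < n, dist (f^[k] x) (f^[k] y) ≤ ε := by
  classical
  -- A ball of radius `ε / 2` in the metric `d_n` holds at most one point of a separated set, so a
  -- finite subcover bounds all their cardinalities.
  obtain ⟨t, ht⟩ := isCompact_univ.elim_finite_subcover
    (fun x : X => ⋂ k : Fin n, {y | dist (f^[k] y) (f^[k] x) < ε / 2})
    (fun x => isOpen_iInter_of_finite fun k =>
      isOpen_lt ((hf.iterate k).dist continuous_const) continuous_const)
    (fun x _ => Set.mem_iUnion.2 ⟨x, by simp [hε]⟩)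
  have hcard : ∀ E : Finset X, IsSeparatedSet f n ε E → E.card ≤ t.card := by
    intro E hE
    have hc : ∀ x, ∃ z ∈ t, ∀ k < n, dist (f^[k] x) (f^[k] z) < ε / 2 := by
      intro x
      have := ht (Set.mem_univ x)
      simp only [Set.mem_iUnion, Set.mem_iInter, Set.mem_ofPred_eq] at this
      obtain ⟨z, hz, h⟩ := this
      exact ⟨z, hz, fun k hk => h ⟨k, hk⟩⟩
    choose z hz hzd using hc
    refine Finset.card_le_card_of_injOn z (fun x _ => hz x) fun x hx y hy hxy => ?_
    by_contra hne
    obtain ⟨k, hk, h⟩ := hE x hx y hy hne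
    have h1 := hzd x k hk
    have h2 := hzd y k hk
    rw [← hxy] at h2
    have := dist_triangle_right (f^[k] x) (f^[k] y) (f^[k] (z x))
    linarith
  let P : ℕ → Prop := fun m => ∃ E : Finset X, IsSeparatedSet f n ε E ∧ E.card = m
  have hP0 : P 0 := ⟨∅, by simp [IsSeparatedSet], rfl⟩
  -- A separated set of largest cardinality spans: a point it does not shadow could be added.
  obtain ⟨E, hE, hEc⟩ := Nat.findGreatest_spec (P := P) (Nat.zero_le t.card) hP0
  refine ⟨E, hE, fun x => ?_⟩
  by_contra! hx
  have hxE : x ∉ E := fun h => by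
    obtain ⟨k, _, h'⟩ := hx x h
    rw [dist_self] at h'
    linarith
  have hins : IsSeparatedSet f n ε (insert x E) := by
    intro y hy z hz hyz
    rcases Finset.mem_insert.1 hy with hy' | hy' <;>
      rcases Finset.mem_insert.1 hz with hz' | hz'
    · exact absurd (hy'.trans hz'.symm) hyz
    · exact hy' ▸ hx z hz'
    · obtain ⟨k, hk, h⟩ := hx y hy'
      exact ⟨k, hk, by rwa [hz', dist_comm]⟩
    · exact hE y hy' z hz' hyz
  have h1 : P (E.card + 1) := ⟨_, hins, Finset.card_insert_of_notMem hxE⟩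
  have h2 := Nat.le_findGreatest (P := P) (n := t.card)
    (by rw [← Finset.card_insert_of_notMem hxE]; exact hcard _ hins) h1
  omega

theorem ofReal_sum_exp_le_separatedSum (f : X → X) (φ : C(X, ℝ)) {n : ℕ} {ε : ℝ} {E : Finset X}
    (hE : IsSeparatedSet f n ε E) :
    ENNReal.ofReal (∑ x ∈ E, Real.exp (birkhoffSum f φ n x)) ≤ separatedSum f φ n ε := by
  rw [ENNReal.ofReal_sum_of_nonneg fun _ _ => (Real.exp_pos _).le]
  exact le_iSup₂ (f := fun (E : Finset X) (_ : IsSeparatedSet f n ε E) =>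
    ∑ x ∈ E, ENNReal.ofReal (Real.exp (birkhoffSum f φ n x))) E hE

/-- If the pressure is less than `c`, exponential sums over separated sets are eventually at most
`exp (c n)`. -/
theorem eventually_log_sum_exp_le {f : X → X} {φ : C(X, ℝ)} {c : ℝ} (hc : topPressure f φ < c)
    {ε : ℝ} (hε : 0 < ε) :
    ∀ᶠ n : ℕ in atTop, ∀ E : Finset X, IsSeparatedSet f n ε E → E.Nonempty →
      Real.log (∑ x ∈ E, Real.exp (birkhoffSum f φ n x)) ≤ c * n := by
  have h1 : limsup (fun n : ℕ => ENNReal.log (separatedSum f φ n ε) / (n : EReal)) atTop < c :=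
    lt_of_le_of_lt (le_iSup₂ (f := fun (ε : ℝ) (_ : 0 < ε) =>
      limsup (fun n : ℕ => ENNReal.log (separatedSum f φ n ε) / (n : EReal)) atTop) ε hε) hc
  filter_upwards [eventually_lt_of_limsup_lt h1, eventually_gt_atTop 0] with n hn hn0 E hE hne
  have hpos : 0 < ∑ x ∈ E, Real.exp (birkhoffSum f φ n x) :=
    Finset.sum_pos (fun _ _ => Real.exp_pos _) hne
  rw [EReal.div_lt_iff (by exact_mod_cast hn0) (EReal.natCast_ne_top n)] at hn
  have h2 := (ENNReal.log_le_log (ofReal_sum_exp_le_separatedSum f φ hE)).trans_lt hn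
  rw [ENNReal.log_ofReal_of_pos hpos] at h2
  have h3 : ((c : EReal) * (n : EReal)) = ((c * n : ℝ) : EReal) := by
    rw [EReal.coe_mul]; rfl
  rw [h3] at h2
  exact (EReal.coe_lt_coe_iff.1 h2).le

/-- If the pressure exceeds `c`, then at some scale, separated sets with exponential sums at
least `exp (c n)` occur for infinitely many `n`. -/
theorem exists_frequently_exp_lt_sum {f : X → X} {φ : C(X, ℝ)} {c : ℝ}
    (hc : (c : EReal) < topPressure f φ) :
    ∃ ε > 0, ∃ᶠ n : ℕ in atTop, 0 < n ∧ ∃ E : Finset X, IsSeparatedSet f n ε E ∧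
      Real.exp (c * n) < ∑ x ∈ E, Real.exp (birkhoffSum f φ n x) := by
  obtain ⟨ε, hc⟩ := lt_iSup_iff.1 hc
  obtain ⟨hε, hc⟩ := lt_iSup_iff.1 hc
  refine ⟨ε, hε, ((frequently_lt_of_lt_limsup (by isBoundedDefault) hc).and_eventually
    (eventually_gt_atTop 0)).mono fun n ⟨hn, hn0⟩ => ⟨hn0, ?_⟩⟩
  rw [EReal.lt_div_iff (by exact_mod_cast hn0) (EReal.natCast_ne_top n)] at hn
  have h3 : ((c : EReal) * (n : EReal)) = ((c * n : ℝ) : EReal) := by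
    rw [EReal.coe_mul]; rfl
  have h4 : ((c * n : ℝ) : EReal) = ENNReal.log (ENNReal.ofReal (Real.exp (c * n))) := by
    rw [ENNReal.log_ofReal_of_pos (Real.exp_pos _), Real.log_exp]
  rw [h3, h4, ENNReal.log_lt_log_iff] at hn
  obtain ⟨E, hn⟩ := lt_iSup_iff.1 hn
  obtain ⟨hE, hn⟩ := lt_iSup_iff.1 hn
  refine ⟨E, hE, ?_⟩
  rw [← ENNReal.ofReal_sum_of_nonneg fun _ _ => (Real.exp_pos _).le] at hn
  exact (ENNReal.ofReal_lt_ofReal_iff_of_nonneg (Real.exp_pos _).le).1 hn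

end Separated

/-! ### Misiurewicz's estimate for one partition. -/

section UpperBound

variable {X : Type*} [MeasurableSpace X] {A : Type*} [Fintype A]

theorem integral_comp_fibers (μ : Measure X) [IsProbabilityMeasure μ] {η : X → A}
    (hη : MeasurableFibers η) (F : A → ℝ) :
    Integrable (fun x => F (η x)) μ ∧ ∫ x, F (η x) ∂μ = ∑ a, μ.real (η ⁻¹' {a}) * F a := by
  let _ : MeasurableSpace A := ⊤
  have hm : Measurable η := measurable_to_countable' hη
  have hi : Integrable F (μ.map η) := by
    have := Measure.isProbabilityMeasure_map (μ := μ) hm.aemeasurable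
    exact Integrable.of_finite
  refine ⟨(integrable_map_measure hi.aestronglyMeasurable hm.aemeasurable).1 hi, ?_⟩
  rw [← integral_map hm.aemeasurable hi.aestronglyMeasurable, integral_fintype hi]
  refine Finset.sum_congr rfl fun a _ => ?_
  rw [map_measureReal_apply hm (measurableSet_singleton a), smul_eq_mul]

variable [MetricSpace X] [CompactSpace X] [BorelSpace X]

theorem continuousMap_integrable (φ : C(X, ℝ)) (μ : Measure X) [IsFiniteMeasure μ] :
    Integrable φ μ :=
  φ.continuous.integrable_of_hasCompactSupport (HasCompactSupport.of_compactSpace _)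

theorem integral_birkhoffSum {f : X → X} (hf : Continuous f) (φ : C(X, ℝ)) {μ : Measure X}
    [IsProbabilityMeasure μ] (hμ : MeasurePreserving f μ μ) (n : ℕ) :
    ∫ x, birkhoffSum f φ n x ∂μ = n * ∫ x, φ x ∂μ := by
  have h : ∀ k, ∫ x, φ (f^[k] x) ∂μ = ∫ x, φ x ∂μ := fun k => by
    conv_rhs => rw [← (hμ.iterate k).map_eq]
    rw [integral_map (hμ.iterate k).measurable.aemeasurable
      φ.continuous.aestronglyMeasurable]
  simp only [birkhoffSum]
  have hi : ∀ k ∈ Finset.range n, Integrable (fun x => φ (f^[k] x)) μ := fun k _ =>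
    continuousMap_integrable (φ.comp ⟨f^[k], hf.iterate k⟩) μ
  rw [integral_finsetSum _ hi]
  simp [h]

/-- A finite partition is approximated from inside by pairwise disjoint closed sets, with little
loss of entropy. -/
theorem exists_closed_approx {μ : Measure X} [IsProbabilityMeasure μ] {ξ : X → A}
    (hξ : MeasurableFibers ξ) :
    ∃ (K : A → Set X) (η : X → Option A), (∀ a, IsClosed (K a)) ∧ (∀ a, K a ⊆ ξ ⁻¹' {a}) ∧
      (∀ x a, η x = some a ↔ x ∈ K a) ∧ MeasurableFibers η ∧
      partitionEntropy μ (fun x => (ξ x, η x)) - partitionEntropy μ η ≤ 1 := by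
  classical
  obtain ⟨x₀⟩ : Nonempty X := nonempty_of_isProbabilityMeasure μ
  have hA : (0 : ℝ) < Fintype.card A := by
    have : Nonempty A := ⟨ξ x₀⟩
    exact_mod_cast Fintype.card_pos
  -- Leftover pieces of mass below `r` contribute less than `1 / card A` each, hence at most `1` in
  -- all.
  obtain ⟨r, hr, hr'⟩ : ∃ r > 0, ∀ t, |t| < r → Real.negMulLog t < 1 / Fintype.card A := by
    have h := Real.continuous_negMulLog.tendsto 0
    rw [Real.negMulLog_zero] at h
    obtain ⟨r, hr, h'⟩ := Metric.eventually_nhds_iff.1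
      (h.eventually_lt_const (show (0 : ℝ) < 1 / Fintype.card A by positivity))
    exact ⟨r, hr, fun t ht => h' (by simpa using ht)⟩
  have hK : ∀ a, ∃ F ⊆ ξ ⁻¹' {a}, IsClosed F ∧ μ (ξ ⁻¹' {a} \ F) < ENNReal.ofReal r := fun a =>
    (hξ a).exists_isClosed_sdiff_lt (measure_ne_top _ _) (by simpa using hr)
  choose K hKs hKc hKμ using hK
  set η : X → Option A := fun x => if x ∈ K (ξ x) then some (ξ x) else none with hη
  have hηs : ∀ x a, η x = some a ↔ x ∈ K a := by
    intro x a
    simp only [hη]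
    constructor
    · intro h
      split_ifs at h with hx
      rwa [← Option.some.inj h]
    · intro h
      have : ξ x = a := hKs a h
      subst this
      simp [h]
  have hsome : ∀ a, η ⁻¹' {some a} = K a := fun a => by ext x; simp [hηs]
  have hηm : MeasurableFibers η := by
    rintro (_ | a)
    · have : η ⁻¹' {none} = (⋃ a, K a)ᶜ := by
        ext x
        simp [← hηs, Option.eq_none_iff_forall_ne_some]
      rw [this]
      exact (MeasurableSet.iUnion fun a => (hKc a).measurableSet).compl
    · rw [hsome]
      exact (hKc a).measurableSet
  refine ⟨K, η, hKc, hKs, hηs, hηm, ?_⟩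
  -- The joint partition consists of the cores `K a` and the leftovers `ξ ⁻¹' {a} \ K a`, while `η`
  -- merges the leftovers. The entropies of the cores cancel.
  have e1 : partitionEntropy μ (fun x => (ξ x, η x)) =
      ∑ a, Real.negMulLog (μ.real (ξ ⁻¹' {a} \ K a)) + ∑ a, Real.negMulLog (μ.real (K a)) := by
    rw [partitionEntropy, Fintype.sum_prod_type, ← Finset.sum_add_distrib]
    refine Finset.sum_congr rfl fun a _ => ?_
    rw [Fintype.sum_option, Finset.sum_eq_single a]
    · congr 3
      · ext x
        simp only [Set.mem_preimage, Set.mem_singleton_iff, Prod.mk.injEq, Set.mem_sdiff, ← hηs]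
        constructor
        · rintro ⟨rfl, h⟩
          simp [h]
        · rintro ⟨rfl, h⟩
          simp only [hη] at h ⊢
          simpa using h
      · ext x
        simp only [Set.mem_preimage, Set.mem_singleton_iff, Prod.mk.injEq, hηs]
        exact ⟨fun h => h.2, fun h => ⟨hKs a h, h⟩⟩
    · intro b _ hb
      have : (fun x => (ξ x, η x)) ⁻¹' {(a, some b)} = ∅ := by
        ext x
        simp only [Set.mem_preimage, Set.mem_singleton_iff, Prod.mk.injEq, hηs,
          Set.mem_empty_iff_false, iff_false, not_and]
        rintro rfl h
        exact hb (hKs b h).symm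
      simp [this]
    · simp
  have e2 : partitionEntropy μ η =
      Real.negMulLog (μ.real (η ⁻¹' {none})) + ∑ a, Real.negMulLog (μ.real (K a)) := by
    rw [partitionEntropy, Fintype.sum_option]
    simp_rw [hsome]
  have e3 : ∑ a, Real.negMulLog (μ.real (ξ ⁻¹' {a} \ K a)) ≤ 1 := by
    calc _ ≤ ∑ _a : A, 1 / (Fintype.card A : ℝ) := by
          refine Finset.sum_le_sum fun a _ => (hr' _ ?_).le
          rw [abs_of_nonneg measureReal_nonneg]
          exact (ENNReal.lt_ofReal_iff_toReal_lt (measure_ne_top _ _)).1 (hKμ a)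
      _ = 1 := by simp [hA.ne']
  have e4 : 0 ≤ Real.negMulLog (μ.real (η ⁻¹' {none})) :=
    Real.negMulLog_nonneg measureReal_nonneg measureReal_le_one
  linarith

/-- If every point is shadowed by a point of `E` that leaves only two choices for each label, then
`H(ηⁿ) + ∫ g ≤ n log 2 + log ∑_E exp u`, when `g ≤ u` up to an error along shadowing. -/
theorem partitionEntropy_add_integral_le {μ : Measure X} [IsProbabilityMeasure μ] {n : ℕ}
    {η : X → Fin n → A} (hη : MeasurableFibers η) (g : C(X, ℝ)) (E : Finset X) (y : X → X)
    (hy : ∀ x, y x ∈ E) (r : ℝ) (hr : ∀ x, g x ≤ g (y x) + r)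
    (L : X → Fin n → Finset A) (hL : ∀ z i, (L z i).card ≤ 2) (hηL : ∀ x i, η x i ∈ L (y x) i) :
    partitionEntropy μ η + ∫ x, g x ∂μ ≤
      n * Real.log 2 + (r + 1) + Real.log (∑ z ∈ E, Real.exp (g z)) := by
  classical
  obtain ⟨x₀⟩ : Nonempty X := nonempty_of_isProbabilityMeasure μ
  set α : (Fin n → A) → ℝ := fun c => sSup (g '' (η ⁻¹' {c}))
  have hbdd : ∀ c, BddAbove (g '' (η ⁻¹' {c})) := fun c =>
    (isCompact_range g.continuous).bddAbove.mono (Set.image_subset_range _ _)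
  have hgα : ∀ x, g x ≤ α (η x) := fun x => le_csSup (hbdd _) ⟨x, rfl, rfl⟩
  -- On an empty cell `sSup` is the default `0`, which would add spurious terms to `Z`; only
  -- nonempty cells are kept.
  set s : Finset (Fin n → A) := Finset.univ.filter fun c => (η ⁻¹' {c}).Nonempty with hs
  have : Nonempty X := ⟨x₀⟩
  have hxc : ∀ c ∈ s, ∃ x, η x = c ∧ α c - 1 < g x := by
    intro c hc
    obtain ⟨_, ⟨x, hx, rfl⟩, h⟩ := exists_lt_of_lt_csSup
      (((Finset.mem_filter.1 hc).2).image g) (sub_one_lt (α c))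
    exact ⟨x, hx, h⟩
  choose! xc hxc hxc' using hxc
  set p : (Fin n → A) → ℝ := fun c => μ.real (η ⁻¹' {c}) with hp
  have hp0 : ∀ c, c ∉ s → p c = 0 := by
    intro c hc
    have : η ⁻¹' {c} = ∅ := by
      rw [← Set.not_nonempty_iff_eq_empty]
      simpa [hs] using hc
    simp [hp, this]
  have hsub : ∀ F : (Fin n → A) → ℝ, (∀ c, p c = 0 → F c = 0) → ∑ c ∈ s, F c = ∑ c, F c :=
    fun F hF => Finset.sum_subset (Finset.subset_univ _) fun c _ hc => hF c (hp0 c hc)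
  set Z : ℝ := ∑ c ∈ s, Real.exp (α c) with hZ
  have hsne : s.Nonempty := ⟨η x₀, Finset.mem_filter.2 ⟨Finset.mem_univ _, x₀, rfl⟩⟩
  have hZ0 : 0 < Z := Finset.sum_pos (fun _ _ => Real.exp_pos _) hsne
  have hsum1 : ∑ c ∈ s, p c = 1 := by
    rw [hsub p fun _ h => h]; exact sum_real_fibers μ hη
  -- Gibbs' inequality with the weights `exp (α c) / Z` gives `H(η) + ∑ p c * α c ≤ log Z`.
  have hG := sum_negMulLog_le_of_sum_le s p (fun c => Real.exp (α c) / Z)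
    (fun _ _ => measureReal_nonneg) (fun _ _ => by positivity)
    (fun _ _ h => absurd h (by positivity))
    (by rw [hsum1, ← Finset.sum_div, div_self hZ0.ne'])
  have hG2 : ∑ c ∈ s, -(p c * Real.log (Real.exp (α c) / Z)) =
      Real.log Z - ∑ c ∈ s, p c * α c := by
    simp_rw [Real.log_div (Real.exp_pos _).ne' hZ0.ne', Real.log_exp]
    have h : Real.log Z = ∑ c ∈ s, p c * Real.log Z := by
      rw [← Finset.sum_mul, hsum1, one_mul]
    conv_rhs => rw [h, ← Finset.sum_sub_distrib]
    exact Finset.sum_congr rfl fun c _ => by ring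
  rw [hG2, hsub _ fun c h => by rw [h, Real.negMulLog_zero],
    hsub _ fun c h => by rw [h, zero_mul]] at hG
  have hint : ∫ x, g x ∂μ ≤ ∑ c, p c * α c := by
    obtain ⟨h1, h2⟩ := integral_comp_fibers μ hη α
    rw [← h2]
    exact integral_mono (continuousMap_integrable g μ) h1 hgα
  have hEne : E.Nonempty := ⟨_, hy x₀⟩
  have hSE : 0 < ∑ z ∈ E, Real.exp (g z) := Finset.sum_pos (fun _ _ => Real.exp_pos _) hEne
  -- Each cell has a point where `g` is within `1` of its supremum, and the shadowing point in `E`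
  -- costs a further `r`. A point of `E` serves at most `2 ^ n` cells, as it leaves two labels at
  -- each time.
  have hZle : Z ≤ 2 ^ n * (Real.exp (r + 1) * ∑ z ∈ E, Real.exp (g z)) := by
    calc Z ≤ ∑ c ∈ s, Real.exp (r + 1) * Real.exp (g (y (xc c))) := by
          refine Finset.sum_le_sum fun c hc => ?_
          rw [← Real.exp_add, Real.exp_le_exp]
          have := hxc' c hc
          have := hr (xc c)
          linarith
      _ = ∑ z ∈ E, ∑ c ∈ s with y (xc c) = z, Real.exp (r + 1) * Real.exp (g (y (xc c))) :=
          (Finset.sum_fiberwise_of_maps_to (fun c _ => hy _) _).symm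
      _ ≤ ∑ z ∈ E, 2 ^ n * (Real.exp (r + 1) * Real.exp (g z)) := by
          refine Finset.sum_le_sum fun z _ => ?_
          have h1 : ∑ c ∈ s with y (xc c) = z, Real.exp (r + 1) * Real.exp (g (y (xc c))) =
              (s.filter fun c => y (xc c) = z).card * (Real.exp (r + 1) * Real.exp (g z)) := by
            rw [← nsmul_eq_mul, ← Finset.sum_const]
            exact Finset.sum_congr rfl fun c hc => by rw [(Finset.mem_filter.1 hc).2]
          rw [h1]
          refine mul_le_mul_of_nonneg_right ?_ (by positivity)
          have h2 : (s.filter fun c => y (xc c) = z) ⊆ Fintype.piFinset (L z) := by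
            intro c hc
            obtain ⟨hc1, rfl⟩ := Finset.mem_filter.1 hc
            refine Fintype.mem_piFinset.2 fun i => ?_
            have := hηL (xc c) i
            rwa [hxc c hc1] at this
          have h3 := Finset.card_le_card h2
          rw [Fintype.card_piFinset] at h3
          have h4 : ∏ i, (L z i).card ≤ 2 ^ n := by
            simpa using Finset.prod_le_pow_card Finset.univ (fun i => (L z i).card) 2
              fun i _ => hL z i
          exact_mod_cast h3.trans h4
      _ = _ := by rw [← Finset.mul_sum, ← Finset.mul_sum]
  have hlogZ := Real.log_le_log hZ0 hZle
  rw [Real.log_mul (by positivity) (by positivity), Real.log_mul (by positivity) hSE.ne',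
    Real.log_exp, Real.log_pow] at hlogZ
  have : partitionEntropy μ η = ∑ c, Real.negMulLog (p c) := rfl
  linarith

/-- Misiurewicz's estimate of the entropy of a partition by sums over separated sets. -/
theorem exists_isSeparatedSet_entropy_le {f : X → X} (hf : Continuous f) (φ : C(X, ℝ))
    {μ : Measure X} [IsProbabilityMeasure μ] (hμ : MeasurePreserving f μ μ) {ξ : X → A}
    (hξ : MeasurableFibers ξ) :
    ∃ ε > 0, ∀ n, ∃ E : Finset X, IsSeparatedSet f n ε E ∧ E.Nonempty ∧
      partitionEntropy μ (itinerary f ξ n) + n * ∫ x, φ x ∂μ ≤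
        n * (Real.log 2 + 2) + 1 + Real.log (∑ x ∈ E, Real.exp (birkhoffSum f φ n x)) := by
  classical
  obtain ⟨x₀⟩ : Nonempty X := nonempty_of_isProbabilityMeasure μ
  obtain ⟨K, η, hKc, hKξ, hηK, hηm, hcond⟩ := exists_closed_approx (μ := μ) hξ
  -- The open set of index `a` avoids every core except `K a`. A ball of Lebesgue radius `δ` thus
  -- meets at most one core, leaving only `none` and one other label.
  obtain ⟨δ, hδ, hball⟩ := lebesgue_number_lemma_of_metric (isCompact_univ (X := X))
    (c := fun a : A => ⋂ b : A, if b = a then Set.univ else (K b)ᶜ)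
    (fun a => isOpen_iInter_of_finite fun b => by
      split_ifs
      exacts [isOpen_univ, (hKc b).isOpen_compl])
    (fun x _ => Set.mem_iUnion.2 ⟨ξ x, Set.mem_iInter.2 fun b => by
      split_ifs with h
      exacts [Set.mem_univ _, fun hx => h (hKξ b hx).symm]⟩)
  obtain ⟨δ', hδ', huc⟩ := Metric.uniformContinuous_iff.1
    (CompactSpace.uniformContinuous_of_continuous φ.continuous) 1 one_pos
  choose ι hι using fun x => hball x (Set.mem_univ x)
  have hηι : ∀ x z, dist z x < δ → η z ∈ ({none, some (ι x)} : Finset (Option A)) := by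
    intro x z hz
    have h := Set.mem_iInter.1 (hι x (Metric.mem_ball.2 hz))
    rcases hzη : η z with _ | b
    · simp
    · have hb := h b
      split_ifs at hb with hbx
      · simp [hbx]
      · exact absurd ((hηK z b).1 hzη) hb
  -- Shadowing is only `≤ ε`, while both moduli ask for strict inequality; hence the half.
  have hε : 0 < min δ δ' / 2 := by positivity
  have hεδ : min δ δ' / 2 < δ := by
    have := min_le_left δ δ'
    have : 0 < min δ δ' := by positivity
    linarith
  have hεδ' : min δ δ' / 2 < δ' := by
    have := min_le_right δ δ'
    have : 0 < min δ δ' := by positivity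
    linarith
  refine ⟨min δ δ' / 2, hε, fun n => ?_⟩
  obtain ⟨E, hE, hspan⟩ := exists_isSeparatedSet_spanning hf n hε
  choose y hyE hy using hspan
  refine ⟨E, hE, ⟨_, hyE x₀⟩, ?_⟩
  have h1 := partitionEntropy_add_integral_le (μ := μ) (hηm.itinerary hf.measurable n)
    (birkhoffMap hf φ n) E y hyE n
    (fun x => by
      rw [coe_birkhoffMap]
      have : birkhoffSum f φ n x - birkhoffSum f φ n (y x) ≤ n := by
        rw [birkhoffSum, birkhoffSum, ← Finset.sum_sub_distrib]
        calc _ ≤ ∑ _k ∈ Finset.range n, (1 : ℝ) := by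
              refine Finset.sum_le_sum fun k hk => ?_
              have := huc ((hy x k (Finset.mem_range.1 hk)).trans_lt hεδ')
              rw [Real.dist_eq] at this
              exact (le_abs_self _).trans this.le
          _ = n := by simp
      linarith)
    (fun z i => {none, some (ι (f^[i] z))}) (fun z i => Finset.card_le_two)
    (fun x i => hηι _ _ ((hy x i i.2).trans_lt hεδ))
  rw [coe_birkhoffMap, integral_birkhoffSum hf φ hμ] at h1
  -- Per unit of time the error is `log 2` for the label choices, `1` for the oscillation of `φ` and
  -- `1` for replacing `ξ` by `η`.
  have h2 := partitionEntropy_itinerary_cond_le μ hξ hηm hμ n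
  have h3 : partitionEntropy μ (itinerary f ξ n) ≤
      partitionEntropy μ (fun x => (itinerary f ξ n x, itinerary f η n x)) :=
    partitionEntropy_mono μ ((hξ.itinerary hf.measurable n).prodMk
      (hηm.itinerary hf.measurable n)) fun x y h => (Prod.mk.inj h).1
  have h4 : (n : ℝ) * (partitionEntropy μ (fun x => (ξ x, η x)) - partitionEntropy μ η) ≤ n * 1 :=
    mul_le_mul_of_nonneg_left hcond n.cast_nonneg
  linarith

end UpperBound

/-! ### Upper half of the variational principle, through iterates. -/

section Iterate

/-- Time `i` sits in block `i / N` at offset `i % N`. -/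
theorem itinerary_factorsThrough_iterate {X A : Type*} {f : X → X} {ξ : X → A} {N m n : ℕ}
    (hm : m ≤ N * n) :
    (itinerary f ξ m).FactorsThrough (itinerary f^[N] (itinerary f ξ N) n) := by
  intro x y h
  funext i
  have hN : 0 < N := Nat.pos_of_ne_zero fun h0 => by
    have := i.2
    simp [h0] at hm
    omega
  have hdiv : (i : ℕ) / N < n := Nat.div_lt_of_lt_mul (i.2.trans_le hm)
  have h1 := congrFun (congrFun h ⟨i / N, hdiv⟩) ⟨i % N, Nat.mod_lt _ hN⟩
  simp only [itinerary, ← Function.iterate_mul, ← Function.iterate_add_apply,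
    Nat.mod_add_div] at h1
  exact h1

variable {X : Type*} [MeasurableSpace X] {A : Type*} [Fintype A]
variable [MetricSpace X] [CompactSpace X] [BorelSpace X]

/-- For each `N`, the entropy of `ξ` satisfies the variational inequality up to an error
of order `1 / N`. -/
theorem eventually_partitionEntropy_le {f : X → X} (hf : Continuous f) {φ : C(X, ℝ)}
    {μ : Measure X} [IsProbabilityMeasure μ] (hμ : MeasurePreserving f μ μ) {ξ : X → A}
    (hξ : MeasurableFibers ξ) {c : ℝ} (hc : topPressure f φ < c) {N : ℕ} (hN : 0 < N) :
    ∀ᶠ n : ℕ in atTop, ∀ m ≤ N * n, partitionEntropy μ (itinerary f ξ m) ≤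
      (N * n : ℕ) * (c - ∫ x, φ x ∂μ + (Real.log 2 + 3) / N) := by
  -- Applied to `f^[N]`, the Birkhoff sum of length `N` and the partition of `N`-itineraries, the
  -- estimate loses `log 2 + 2` per `N` steps of `f`. The additive `1` is absorbed by `n ≥ 1`, which
  -- makes the constant `3`.
  obtain ⟨ε, hε, h⟩ := exists_isSeparatedSet_entropy_le (hf.iterate N) (birkhoffMap hf φ N)
    (hμ.iterate N) (hξ.itinerary hf.measurable N)
  have ht : Tendsto (fun n => N * n) atTop atTop :=
    tendsto_id.const_mul_atTop' hN
  filter_upwards [ht.eventually (eventually_log_sum_exp_le hc hε), eventually_ge_atTop 1]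
    with n hn hn1 m hm
  obtain ⟨E, hE, hEne, hH⟩ := h n
  have h1 := hn E (hE.of_iterate hN) hEne
  rw [coe_birkhoffMap, integral_birkhoffSum hf φ hμ, birkhoffSum_iterate] at hH
  have h2 : partitionEntropy μ (itinerary f ξ m) ≤
      partitionEntropy μ (itinerary f^[N] (itinerary f ξ N) n) :=
    partitionEntropy_mono μ
      ((hξ.itinerary hf.measurable N).itinerary (hf.iterate N).measurable n)
      (itinerary_factorsThrough_iterate hm)
  have hN' : (0 : ℝ) < N := by exact_mod_cast hN
  have hn1' : (1 : ℝ) ≤ n := by exact_mod_cast hn1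
  have h3 : ((N * n : ℕ) : ℝ) * (c - ∫ x, φ x ∂μ + (Real.log 2 + 3) / N) =
      c * (N * n : ℕ) - n * (N * ∫ x, φ x ∂μ) + n * (Real.log 2 + 3) := by
    push_cast
    field_simp
  rw [h3]
  linarith

/-- The error of order `1 / N` vanishes as `N → ∞`. Nonnegativity is recorded because
`ENNReal.ofReal` truncates at `0`, and the bound must give back `c` after the integral is added. -/
theorem entropyOfPartition_le {f : X → X} (hf : Continuous f) {φ : C(X, ℝ)}
    {μ : Measure X} [IsProbabilityMeasure μ] (hμ : MeasurePreserving f μ μ) {ξ : X → A}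
    (hξ : MeasurableFibers ξ) {c : ℝ} (hc : topPressure f φ < c) :
    entropyOfPartition f μ ξ ≤ ENNReal.ofReal (c - ∫ x, φ x ∂μ) ∧ 0 ≤ c - ∫ x, φ x ∂μ := by
  set d : ℝ := c - ∫ x, φ x ∂μ
  have hlim : Tendsto (fun N : ℕ => d + (Real.log 2 + 3) / N) atTop (𝓝 d) := by
    simpa using tendsto_const_nhds.add (tendsto_const_div_atTop_nhds_zero_nat (Real.log 2 + 3))
  have hnonneg : ∀ N : ℕ, 0 < N → 0 ≤ d + (Real.log 2 + 3) / N := by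
    intro N hN
    obtain ⟨n, hn, hn1⟩ := ((eventually_partitionEntropy_le hf hμ hξ hc hN).and
      (eventually_ge_atTop 1)).exists
    have h0 := (partitionEntropy_nonneg μ (itinerary f ξ 0)).trans (hn 0 (Nat.zero_le _))
    exact nonneg_of_mul_nonneg_right h0 (by exact_mod_cast Nat.mul_pos hN hn1)
  refine ⟨?_, ge_of_tendsto hlim ((eventually_gt_atTop 0).mono hnonneg)⟩
  refine ge_of_tendsto ((ENNReal.continuous_ofReal.tendsto d).comp hlim)
    ((eventually_gt_atTop 0).mono fun N hN => ?_)
  set D : ℝ := d + (Real.log 2 + 3) / N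
  have hD := hnonneg N hN
  have hlim2 : Tendsto (fun m : ℕ => ENNReal.ofReal ((1 + N / m) * D)) atTop
      (𝓝 (ENNReal.ofReal D)) := by
    refine (ENNReal.continuous_ofReal.tendsto _).comp ?_
    simpa using ((tendsto_const_nhds (x := (1 : ℝ))).add
      (tendsto_const_div_atTop_nhds_zero_nat (N : ℝ))).mul_const D
  rw [Function.comp_apply, ← hlim2.limsup_eq]
  refine limsup_le_limsup ?_
  -- With `n = m / N + 1` one has `m ≤ N * n ≤ m + N`, so rounding to a multiple of `N` costs a
  -- factor `1 + N / m → 1`.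
  have ht : Tendsto (fun m : ℕ => m / N + 1) atTop atTop :=
    tendsto_atTop_mono (fun m => Nat.le_succ _) (Nat.tendsto_div_const_atTop hN.ne')
  filter_upwards [ht.eventually (eventually_partitionEntropy_le hf hμ hξ hc hN),
    eventually_gt_atTop 0] with m hm hm0
  refine ENNReal.ofReal_le_ofReal ?_
  have hm0' : (0 : ℝ) < m := by exact_mod_cast hm0
  rw [div_le_iff₀ hm0']
  have h1 := hm m (by
    have := Nat.div_add_mod m N
    have := Nat.mod_lt m hN
    rw [Nat.mul_add]
    omega)
  refine h1.trans ?_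
  have h2 : N * (m / N + 1) ≤ m + N := by
    have := Nat.mul_div_le m N
    rw [Nat.mul_add]
    omega
  have h3 : ((N * (m / N + 1) : ℕ) : ℝ) ≤ m + N := by exact_mod_cast h2
  calc _ ≤ ((m : ℝ) + N) * D := mul_le_mul_of_nonneg_right h3 hD
    _ = _ := by field_simp

/-- The inequality `h_μ(f) + ∫ φ dμ ≤ P(f, φ)` of the variational principle. -/
theorem measurePressure_le_topPressure {f : X → X} (hf : Continuous f) (φ : C(X, ℝ))
    {μ : ProbabilityMeasure X} (hμ : μ ∈ invariantMeasures f) :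
    measurePressure f μ φ ≤ topPressure f φ := by
  refine EReal.le_of_forall_lt_iff_le.1 fun c hc => ?_
  set r : ℝ := ∫ x, φ x ∂(μ : Measure X) with hr
  have h1 : metricEntropy f μ ≤ ENNReal.ofReal (c - r) :=
    iSup_le fun k => iSup_le fun ξ => iSup_le fun hξ =>
      (entropyOfPartition_le hf hμ hξ.measurableFibers hc).1
  have h0 : 0 ≤ c - r :=
    (entropyOfPartition_le hf hμ (ξ := fun _ => ()) (fun a => by simp) hc).2
  calc measurePressure f μ φ ≤ ((ENNReal.ofReal (c - r) : ℝ≥0∞) : EReal) + (r : EReal) :=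
        add_le_add_left (EReal.coe_ennreal_le_coe_ennreal_iff.2 h1) _
    _ = c := by
        rw [EReal.coe_ennreal_ofReal, max_eq_left h0, ← EReal.coe_add]
        simp

end Iterate

/-! ### Block estimates and almost invariant measures on separated sets. -/

section Blocks

/-- Cutting a window of length `n` into blocks of length `q + 1` from every offset `j ≤ q` uses each
start `i < n` once. Inductively, removing the first block at offset `0` leaves the term of offset
`q` for the window moved by one. Truncated subtraction stops the cutting at `D _ 0 = 0`, so last
blocks may overrun the window. -/
theorem sum_blocks_le {q : ℕ} {D : ℕ → ℕ → ℝ} (h0 : ∀ s, D s 0 = 0)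
    (hD : ∀ s m, D s m ≤ D s (q + 1) + D (s + (q + 1)) (m - (q + 1))) (s n : ℕ) :
    ∑ j ∈ Finset.range (q + 1), D (s + j) (n - j) ≤ ∑ i ∈ Finset.range n, D (s + i) (q + 1) := by
  induction n generalizing s with
  | zero => simp [h0]
  | succ n ih =>
    have h1 := ih (s + 1)
    have h2 := hD s (n + 1)
    rw [Finset.sum_range_succ] at h1
    rw [Finset.sum_range_succ', Finset.sum_range_succ']
    simp only [Nat.add_sub_add_right, add_zero, Nat.sub_zero] at h2 ⊢
    have e : ∀ j, s + 1 + j = s + (j + 1) := fun j => by omega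
    simp only [e] at h1
    linarith

variable {X : Type*} [MeasurableSpace X] {A : Type*} [Fintype A]
variable {σ : Measure X} [IsProbabilityMeasure σ] {f : X → X} {ξ : X → A}

theorem entropyOfPartition_le_metricEntropy (hf : Measurable f) (μ : ProbabilityMeasure X) (hξ : MeasurableFibers ξ) :
    entropyOfPartition f (μ : Measure X) ξ ≤ metricEntropy f μ := by
  set e := Fintype.equivFin A
  have hm : MeasurableFibers (e ∘ ξ) := hξ.comp e
  have h : entropyOfPartition f (μ : Measure X) ξ =
      entropyOfPartition f (μ : Measure X) (e ∘ ξ) := by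
    unfold entropyOfPartition
    congr 1
    ext n
    rw [partitionEntropy_congr (μ : Measure X) (hξ.itinerary hf n) (hm.itinerary hf n)]
    intro x y
    simp [funext_iff, itinerary]
  rw [h]
  exact le_iSup_of_le _ (le_iSup₂_of_le (e ∘ ξ) (measurable_to_countable' hm) le_rfl)

theorem partitionEntropy_itinerary_split (hf : Measurable f) (hξ : MeasurableFibers ξ)
    (s m q : ℕ) :
    partitionEntropy σ (itinerary f ξ m ∘ f^[s]) ≤
      partitionEntropy σ (itinerary f ξ q ∘ f^[s]) +
        partitionEntropy σ (itinerary f ξ (m - q) ∘ f^[s + q]) := by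
  have h1 := (hξ.itinerary hf q).comp_measurable (hf.iterate s)
  have h2 := (hξ.itinerary hf (m - q)).comp_measurable (hf.iterate (s + q))
  refine (partitionEntropy_mono σ (h1.prodMk h2) ?_).trans (partitionEntropy_prodMk_le σ h1 h2)
  intro x y h
  simp only [Function.comp_apply, Prod.mk.injEq, add_comm s q, Function.iterate_add_apply] at h
  exact itinerary_factorsThrough (show m ≤ q + (m - q) by omega) (itinerary_add_eq_iff.2 h)

theorem partitionEntropy_itinerary_zero (s : ℕ) :
    partitionEntropy σ (itinerary f ξ 0 ∘ f^[s]) = 0 := by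
  have : itinerary f ξ 0 ∘ f^[s] = fun _ => Fin.elim0 := by
    ext x i
    exact i.elim0
  rw [this, partitionEntropy_const]

/-- The entropy of a long itinerary is controlled by the average entropy of its blocks. -/
theorem mul_partitionEntropy_itinerary_le (hf : Measurable f) (hξ : MeasurableFibers ξ) (q n : ℕ) :
    (q : ℝ) * partitionEntropy σ (itinerary f ξ n) ≤
      ∑ i ∈ Finset.range n, partitionEntropy σ (itinerary f ξ q ∘ f^[i]) +
        q * (q * Real.log (Fintype.card A)) := by
  rcases q with _ | q
  · simp [partitionEntropy_itinerary_zero]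
  have h1 := sum_blocks_le (D := fun s m => partitionEntropy σ (itinerary f ξ m ∘ f^[s]))
    partitionEntropy_itinerary_zero
    (fun s m => partitionEntropy_itinerary_split (σ := σ) hf hξ s m (q + 1)) 0 n
  simp only [zero_add] at h1
  -- Starting at offset `j` drops `j` symbols, of entropy at most `j * log (card A)`.
  have h2 : ∀ j ∈ Finset.range (q + 1), partitionEntropy σ (itinerary f ξ n) ≤
      ((q + 1 : ℕ) : ℝ) * Real.log (Fintype.card A) +
        partitionEntropy σ (itinerary f ξ (n - j) ∘ f^[j]) := by
    intro j hj
    have h3 := partitionEntropy_itinerary_split (σ := σ) hf hξ 0 n j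
    have h4 := partitionEntropy_le_log_card σ (hξ.itinerary hf j)
    have h5 : ((j : ℝ)) * Real.log (Fintype.card A) ≤
        ((q + 1 : ℕ) : ℝ) * Real.log (Fintype.card A) :=
      mul_le_mul_of_nonneg_right (by exact_mod_cast (Finset.mem_range.1 hj).le)
        (Real.log_natCast_nonneg _)
    simp only [Fintype.card_fun, Fintype.card_fin, Nat.cast_pow, Real.log_pow] at h4
    simp only [Function.iterate_zero, Function.comp_id, zero_add] at h3
    linarith
  have h3 := Finset.sum_le_sum h2
  rw [Finset.sum_add_distrib, Finset.sum_const, Finset.sum_const, Finset.card_range,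
    nsmul_eq_mul, nsmul_eq_mul] at h3
  linarith

/-- The average of the images of `σ` under the first `n` iterates of `f`. -/
noncomputable def averagedMeasure (f : X → X) (σ : Measure X) (n : ℕ) : Measure X :=
  (n : ℝ≥0∞)⁻¹ • ∑ i ∈ Finset.range n, σ.map f^[i]

theorem averagedMeasure_real (hf : Measurable f) (n : ℕ) {s : Set X} (hs : MeasurableSet s) :
    (averagedMeasure f σ n).real s = ∑ i ∈ Finset.range n, (n : ℝ)⁻¹ * σ.real (f^[i] ⁻¹' s) := by
  have h : ∀ i, σ.map f^[i] s = σ (f^[i] ⁻¹' s) := fun i => Measure.map_apply (hf.iterate i) hs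
  simp only [averagedMeasure, measureReal_def, Measure.smul_apply, Measure.finsetSum_apply, h,
    smul_eq_mul, ENNReal.toReal_mul, ENNReal.toReal_inv, ENNReal.toReal_natCast]
  rw [ENNReal.toReal_sum fun i _ => measure_ne_top _ _, Finset.mul_sum]

theorem isProbabilityMeasure_averagedMeasure (hf : Measurable f) {n : ℕ} (hn : 0 < n) :
    IsProbabilityMeasure (averagedMeasure f σ n) := by
  constructor
  have h : ∀ i, σ.map f^[i] Set.univ = 1 := fun i => by
    rw [Measure.map_apply (hf.iterate i) MeasurableSet.univ]
    simp
  simp only [averagedMeasure, Measure.smul_apply, Measure.finsetSum_apply, h, smul_eq_mul,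
    Finset.sum_const, Finset.card_range, nsmul_eq_mul, mul_one]
  exact ENNReal.inv_mul_cancel (by exact_mod_cast hn.ne') (ENNReal.natCast_ne_top n)

/-- Jensen's inequality for the concave `negMulLog`, fibre by fibre. -/
theorem sum_partitionEntropy_le_averagedMeasure (hf : Measurable f) (hξ : MeasurableFibers ξ)
    {n : ℕ} (hn : 0 < n) :
    ∑ i ∈ Finset.range n, partitionEntropy σ (ξ ∘ f^[i]) ≤
      n * partitionEntropy (averagedMeasure f σ n) ξ := by
  have hn' : (0 : ℝ) < n := by exact_mod_cast hn
  rw [← div_le_iff₀' hn', div_eq_inv_mul, Finset.mul_sum]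
  simp only [partitionEntropy, Finset.mul_sum]
  rw [Finset.sum_comm]
  refine Finset.sum_le_sum fun a _ => ?_
  rw [averagedMeasure_real hf n (hξ a)]
  exact Real.concaveOn_negMulLog.le_map_sum (t := Finset.range n) (w := fun _ => (n : ℝ)⁻¹)
    (p := fun i => σ.real (f^[i] ⁻¹' (ξ ⁻¹' {a}))) (fun _ _ => by positivity)
    (by simp [hn'.ne']) (fun _ _ => measureReal_nonneg)

theorem integral_averagedMeasure [MetricSpace X] [CompactSpace X] [BorelSpace X]
    (hf : Continuous f) (n : ℕ) (g : C(X, ℝ)) :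
    ∫ x, g x ∂(averagedMeasure f σ n) =
      (n : ℝ)⁻¹ * ∑ i ∈ Finset.range n, ∫ x, g (f^[i] x) ∂σ := by
  have hm := fun i => (hf.iterate i).measurable
  rw [averagedMeasure, integral_smul_measure, integral_finsetSum_measure]
  · simp only [ENNReal.toReal_inv, ENNReal.toReal_natCast, smul_eq_mul]
    congr 1
    exact Finset.sum_congr rfl fun i _ =>
      integral_map (hm i).aemeasurable g.continuous.aestronglyMeasurable
  · intro i _
    exact continuousMap_integrable g _

/-- The measure with mass `w y` at each point `y` of `E`. -/
noncomputable def weightedDirac (E : Finset X) (w : X → ℝ) : Measure X :=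
  ∑ y ∈ E, ENNReal.ofReal (w y) • Measure.dirac y

open Classical in
theorem weightedDirac_real (E : Finset X) {w : X → ℝ} (hw : ∀ y, 0 ≤ w y) {s : Set X}
    (hs : MeasurableSet s) : (weightedDirac E w).real s = ∑ y ∈ E with y ∈ s, w y := by
  simp only [weightedDirac, measureReal_def, Measure.finsetSum_apply, Measure.smul_apply,
    Measure.dirac_apply' _ hs, smul_eq_mul]
  rw [ENNReal.toReal_sum, Finset.sum_filter]
  · refine Finset.sum_congr rfl fun y _ => ?_
    by_cases h : y ∈ s <;> simp [h, hw y]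
  · intro y _
    by_cases h : y ∈ s <;> simp [h]

theorem isProbabilityMeasure_weightedDirac (E : Finset X) {w : X → ℝ} (hw : ∀ y, 0 ≤ w y)
    (h1 : ∑ y ∈ E, w y = 1) : IsProbabilityMeasure (weightedDirac E w) := by
  constructor
  simp only [weightedDirac, Measure.finsetSum_apply, Measure.smul_apply, measure_univ,
    smul_eq_mul, mul_one]
  rw [← ENNReal.ofReal_sum_of_nonneg fun y _ => hw y, h1, ENNReal.ofReal_one]

theorem integral_weightedDirac [MetricSpace X] [CompactSpace X] [BorelSpace X] (E : Finset X)
    {w : X → ℝ} (hw : ∀ y, 0 ≤ w y) (g : C(X, ℝ)) :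
    ∫ x, g x ∂(weightedDirac E w) = ∑ y ∈ E, w y * g y := by
  rw [weightedDirac, integral_finsetSum_measure]
  · refine Finset.sum_congr rfl fun y _ => ?_
    rw [integral_smul_measure, integral_dirac, ENNReal.toReal_ofReal (hw y), smul_eq_mul]
  · intro y _
    exact (continuousMap_integrable g _).smul_measure ENNReal.ofReal_ne_top

/-- By injectivity each fibre carries at most one atom. -/
theorem partitionEntropy_weightedDirac (E : Finset X) {w : X → ℝ} (hw : ∀ y, 0 ≤ w y)
    {α : X → A} (hα : MeasurableFibers α) (hinj : Set.InjOn α E) :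
    partitionEntropy (weightedDirac E w) α = ∑ y ∈ E, Real.negMulLog (w y) := by
  classical
  rw [partitionEntropy, ← Finset.sum_fiberwise (s := E) (g := α)]
  refine Finset.sum_congr rfl fun a _ => ?_
  rw [weightedDirac_real E hw (hα a)]
  simp only [Set.mem_preimage, Set.mem_singleton_iff]
  have hc : (E.filter fun y => α y = a).card ≤ 1 := by
    refine Finset.card_le_one.2 fun x hx y hy => ?_
    rw [Finset.mem_filter] at hx hy
    exact hinj hx.1 hy.1 (hx.2.trans hy.2.symm)
  rcases Nat.le_one_iff_eq_zero_or_eq_one.1 hc with h | h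
  · simp [Finset.card_eq_zero.1 h]
  · obtain ⟨y, hy⟩ := Finset.card_eq_one.1 h
    simp [hy]

variable [MetricSpace X] [CompactSpace X] [BorelSpace X]

/-- An exponential sum over a separated set gives an almost invariant measure with large
pressure. -/
theorem exists_almost_invariant (hf : Continuous f) (φ : C(X, ℝ)) {c ε : ℝ} {n : ℕ} (hn : 0 < n)
    {E : Finset X} (hE : IsSeparatedSet f n ε E)
    (hc : Real.exp (c * n) < ∑ x ∈ E, Real.exp (birkhoffSum f φ n x)) :
    ∃ ν : ProbabilityMeasure X,
      (∀ g : C(X, ℝ), |∫ x, g (f x) ∂(ν : Measure X) - ∫ x, g x ∂(ν : Measure X)| ≤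
        2 * ‖g‖ / n) ∧
      ∀ (k : ℕ) (ξ : X → Fin k), MeasurableFibers ξ → (∀ x y, ξ x = ξ y → dist x y ≤ ε) →
        ∀ q : ℕ, 0 < q → c ≤ partitionEntropy (ν : Measure X) (itinerary f ξ q) / q +
          q * Real.log k / n + ∫ x, φ x ∂(ν : Measure X) := by
  have hn' : (0 : ℝ) < n := by exact_mod_cast hn
  have hm := hf.measurable
  set Z : ℝ := ∑ x ∈ E, Real.exp (birkhoffSum f φ n x) with hZ
  have hZ0 : 0 < Z := (Real.exp_pos _).trans hc
  -- Gibbs weights turn Gibbs' inequality into an equality: entropy plus the integral of the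
  -- Birkhoff sum is exactly `log Z`.
  set w : X → ℝ := fun x => Real.exp (birkhoffSum f φ n x) / Z with hwdef
  have hw : ∀ y, 0 ≤ w y := fun y => by positivity
  have hw1 : ∑ y ∈ E, w y = 1 := by rw [← Finset.sum_div, div_self hZ0.ne']
  set σ := weightedDirac E w
  have hσ : IsProbabilityMeasure σ := isProbabilityMeasure_weightedDirac E hw hw1
  refine ⟨⟨averagedMeasure f σ n, isProbabilityMeasure_averagedMeasure hm hn⟩, fun g => ?_,
    fun k ξ hξ hdiam q hq => ?_⟩
  · rw [ProbabilityMeasure.coe_mk]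
    have h1 := integral_averagedMeasure (σ := σ) hf n g
    have h2 := integral_averagedMeasure (σ := σ) hf n (g.comp ⟨f, hf⟩)
    simp only [ContinuousMap.comp_apply, ContinuousMap.coe_mk,
      ← Function.iterate_succ_apply' f] at h2
    -- The orbit average telescopes, leaving two boundary terms of size at most `‖g‖`.
    rw [h1, h2, ← mul_sub, ← Finset.sum_sub_distrib,
      Finset.sum_range_sub fun i => ∫ x, g (f^[i] x) ∂σ, abs_mul, abs_inv, Nat.abs_cast,
      div_eq_inv_mul]
    refine mul_le_mul_of_nonneg_left ?_ (by positivity)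
    have hb : ∀ i, |∫ x, g (f^[i] x) ∂σ| ≤ ‖g‖ := fun i => by
      have := norm_integral_le_of_norm_le_const (μ := σ) (f := fun x => g (f^[i] x)) (C := ‖g‖)
        (Eventually.of_forall fun x => g.norm_coe_le_norm _)
      simpa using this
    calc _ ≤ |∫ x, g (f^[n] x) ∂σ| + |∫ x, g (f^[0] x) ∂σ| := abs_sub _ _
      _ ≤ 2 * ‖g‖ := by linarith [hb n, hb 0]
  · rw [ProbabilityMeasure.coe_mk]
    have hq' : (0 : ℝ) < q := by exact_mod_cast hq
    -- Points with equal itineraries stay within `ε` for times below `n`, which separation forbids.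
    have hinj : Set.InjOn (itinerary f ξ n) E := by
      intro x hx y hy hxy
      by_contra hne
      obtain ⟨i, hi, h⟩ := hE x hx y hy hne
      exact absurd (hdiam _ _ (congrFun hxy ⟨i, hi⟩)) (not_le.2 h)
    have h1 : partitionEntropy σ (itinerary f ξ n) + ∫ x, birkhoffMap hf φ n x ∂σ =
        Real.log Z := by
      rw [partitionEntropy_weightedDirac E hw (hξ.itinerary hm n) hinj,
        integral_weightedDirac E hw, coe_birkhoffMap, ← Finset.sum_add_distrib,
        ← one_mul (Real.log Z), ← hw1, Finset.sum_mul]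
      refine Finset.sum_congr rfl fun y _ => ?_
      rw [Real.negMulLog]
      simp only [hwdef]
      rw [Real.log_div (Real.exp_pos _).ne' hZ0.ne', Real.log_exp]
      ring
    have h2 : c * n < Real.log Z := (Real.lt_log_iff_exp_lt hZ0).2 hc
    have h3 : ∫ x, birkhoffMap hf φ n x ∂σ = n * ∫ x, φ x ∂(averagedMeasure f σ n) := by
      rw [integral_averagedMeasure hf, mul_inv_cancel_left₀ hn'.ne', coe_birkhoffMap]
      simp only [birkhoffSum]
      have hi : ∀ k ∈ Finset.range n, Integrable (fun x => φ (f^[k] x)) σ := fun k _ =>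
        continuousMap_integrable (φ.comp ⟨f^[k], hf.iterate k⟩) σ
      rw [integral_finsetSum _ hi]
    have h4 := mul_partitionEntropy_itinerary_le (σ := σ) hm hξ q n
    have h5 := sum_partitionEntropy_le_averagedMeasure (σ := σ) hm (hξ.itinerary hm q) hn
    rw [Fintype.card_fin] at h4
    have h6 : q * (c * n) ≤ n * partitionEntropy (averagedMeasure f σ n) (itinerary f ξ q) +
        q * (q * Real.log k) + q * (n * ∫ x, φ x ∂(averagedMeasure f σ n)) := by
      have := mul_le_mul_of_nonneg_left (h1 ▸ h2.le) hq'.le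
      rw [h3] at this
      linarith
    have h7 : q * (c * n) ≤ q * ((partitionEntropy (averagedMeasure f σ n) (itinerary f ξ q) / q +
        q * Real.log k / n + ∫ x, φ x ∂(averagedMeasure f σ n)) * n) := by
      refine h6.trans_eq ?_
      field_simp
    exact le_of_mul_le_mul_right (le_of_mul_le_mul_left h7 hq') hn'

end Blocks

/-! ### Lower half of the variational principle, through weak-* limits. -/

section LowerBound

theorem frontier_iInter_subset_of_finite {X ι : Type*} [TopologicalSpace X] [Finite ι]
    (s : ι → Set X) : frontier (⋂ i, s i) ⊆ ⋃ i, frontier (s i) := by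
  intro x hx
  by_contra h
  simp only [Set.mem_iUnion, not_exists] at h
  refine hx.2 ?_
  rw [interior_iInter_of_finite, Set.mem_iInter]
  intro i
  by_contra hi
  exact h i ⟨closure_mono (Set.iInter_subset _ i) hx.1, hi⟩

variable {X : Type*} [MeasurableSpace X] [MetricSpace X] [BorelSpace X]

/-- Portmanteau: masses of sets with null frontier converge, and `negMulLog` is continuous. -/
theorem tendsto_partitionEntropy {ι A : Type*} [Fintype A] {L : Filter ι}
    {ν : ι → ProbabilityMeasure X} {μ : ProbabilityMeasure X} (h : Tendsto ν L (𝓝 μ))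
    {α : X → A} (hα : ∀ a, (μ : Measure X) (frontier (α ⁻¹' {a})) = 0) :
    Tendsto (fun i => partitionEntropy (ν i : Measure X) α) L
      (𝓝 (partitionEntropy (μ : Measure X) α)) := by
  refine tendsto_finsetSum _ fun a _ => (Real.continuous_negMulLog.tendsto _).comp ?_
  have h1 := ProbabilityMeasure.tendsto_measure_of_null_frontier_of_tendsto' h (hα a)
  exact (ENNReal.tendsto_toReal (measure_ne_top _ _)).comp h1

theorem mem_invariantMeasures_of_integral_eq {f : X → X} (hf : Continuous f)
    {μ : ProbabilityMeasure X}
    (h : ∀ g : C(X, ℝ), ∫ x, g (f x) ∂(μ : Measure X) = ∫ x, g x ∂(μ : Measure X)) :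
    μ ∈ invariantMeasures f := by
  refine ⟨hf.measurable, ?_⟩
  have := Measure.isProbabilityMeasure_map (μ := (μ : Measure X)) hf.measurable.aemeasurable
  refine ext_of_forall_integral_eq_of_IsFiniteMeasure fun g => ?_
  rw [integral_map hf.measurable.aemeasurable g.continuous.aestronglyMeasurable]
  exact h g.toContinuousMap

variable [CompactSpace X]

theorem exists_partition_null_frontier (μ : Measure X) [IsProbabilityMeasure μ] {ε : ℝ}
    (hε : 0 < ε) :
    ∃ (k : ℕ) (ξ : X → Fin k), MeasurableFibers ξ ∧ (∀ x y, ξ x = ξ y → dist x y ≤ ε) ∧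
      ∀ a, μ (frontier (ξ ⁻¹' {a})) = 0 := by
  classical
  have hr : ∀ x : X, ∃ r ∈ Set.Ioo 0 (ε / 2), μ (frontier (Metric.ball x r)) = 0 := by
    intro x
    obtain ⟨r, hr, h⟩ := exists_null_frontier_thickening μ {x} (half_pos hε)
    exact ⟨r, hr, by rwa [Metric.thickening_singleton] at h⟩
  choose r hr hr0 using hr
  obtain ⟨t, ht⟩ := isCompact_univ.elim_finite_subcover (fun x : X => Metric.ball x (r x))
    (fun x => Metric.isOpen_ball)
    (fun x _ => Set.mem_iUnion.2 ⟨x, Metric.mem_ball_self (hr x).1⟩)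
  -- Points are labelled by the balls of the cover that contain them. Equal labels mean a common
  -- ball of radius below `ε / 2`, and frontiers of cells lie in the null frontiers of the balls.
  set ζ : X → (t → Bool) := fun x i => decide (x ∈ Metric.ball (i : X) (r i)) with hζ
  have hfib : ∀ b : t → Bool, ζ ⁻¹' {b} = ⋂ i : t, if b i = true
      then Metric.ball (i : X) (r i) else (Metric.ball (i : X) (r i))ᶜ := by
    intro b
    ext x
    simp only [hζ, Set.mem_preimage, Set.mem_singleton_iff, funext_iff, Set.mem_iInter]
    refine forall_congr' fun i => ?_
    cases hb : b i <;> simp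
  have hζm : MeasurableFibers ζ := by
    intro b
    rw [hfib]
    refine MeasurableSet.iInter fun i => ?_
    split_ifs
    exacts [measurableSet_ball, measurableSet_ball.compl]
  have hζd : ∀ x y, ζ x = ζ y → dist x y ≤ ε := by
    intro x y h
    have hx := ht (Set.mem_univ x)
    simp only [Set.mem_iUnion] at hx
    obtain ⟨z, hz, hxz⟩ := hx
    have h1 := congrFun h ⟨z, hz⟩
    simp only [hζ, decide_eq_decide] at h1
    have h2 := Metric.mem_ball.1 (h1.1 hxz)
    have h3 := Metric.mem_ball.1 hxz
    have := (hr z).2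
    have := dist_triangle_right x y z
    linarith
  have hζf : ∀ b, μ (frontier (ζ ⁻¹' {b})) = 0 := by
    intro b
    rw [hfib]
    refine measure_mono_null (frontier_iInter_subset_of_finite _)
      (measure_iUnion_null fun i => ?_)
    split_ifs
    · exact hr0 _
    · rw [frontier_compl]
      exact hr0 _
  set e := Fintype.equivFin (t → Bool)
  refine ⟨_, e ∘ ζ, hζm.comp e, fun x y h => hζd x y (e.injective h), fun a => ?_⟩
  have : (e ∘ ζ) ⁻¹' {a} = ζ ⁻¹' {e.symm a} := by
    ext x
    simp [Equiv.eq_symm_apply]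
  rw [this]
  exact hζf _

theorem tendsto_integral {ι : Type*} {L : Filter ι} {ν : ι → ProbabilityMeasure X}
    {μ : ProbabilityMeasure X} (h : Tendsto ν L (𝓝 μ)) (g : C(X, ℝ)) :
    Tendsto (fun i => ∫ x, g x ∂(ν i : Measure X)) L (𝓝 (∫ x, g x ∂(μ : Measure X))) :=
  ProbabilityMeasure.tendsto_iff_forall_integral_tendsto.1 h
    (BoundedContinuousFunction.mkOfCompact g)

/-- The other half of the variational principle: invariant measures have pressures arbitrarily
close to the topological pressure. -/
theorem exists_le_measurePressure {f : X → X} (hf : Continuous f) {φ : C(X, ℝ)} {c : ℝ}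
    (hc : (c : EReal) < topPressure f φ) :
    ∃ μ ∈ invariantMeasures f, (c : EReal) ≤ measurePressure f μ φ := by
  obtain ⟨ε, hε, hfreq⟩ := exists_frequently_exp_lt_sum hc
  set G : Set ℕ := {n | 0 < n ∧ ∃ E : Finset X, IsSeparatedSet f n ε E ∧
      Real.exp (c * n) < ∑ x ∈ E, Real.exp (birkhoffSum f φ n x)}
  have hν := fun (n : ℕ) (hn : n ∈ G) =>
    exists_almost_invariant hf φ hn.1 hn.2.choose_spec.1 hn.2.choose_spec.2
  obtain ⟨n₀, hn₀⟩ := hfreq.exists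
  have : Nonempty (ProbabilityMeasure X) := ⟨(hν n₀ hn₀).choose⟩
  choose! ν hν1 hν2 using hν
  have : NeBot (atTop ⊓ 𝓟 G) := frequently_mem_iff_neBot.1 hfreq
  -- The ultrafilter selects the infinitely many times `n` with large sums, along which the measures
  -- converge by compactness.
  set U : Ultrafilter ℕ := Ultrafilter.of (atTop ⊓ 𝓟 G)
  have hU : (U : Filter ℕ) ≤ atTop := (Ultrafilter.of_le _).trans inf_le_left
  have hUG : ∀ᶠ n in (U : Filter ℕ), n ∈ G :=
    ((Ultrafilter.of_le _).trans inf_le_right) (mem_principal_self G)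
  obtain ⟨μ, -, hμ⟩ := isCompact_univ.ultrafilter_le_nhds (U.map ν) (by simp)
  replace hμ : Tendsto ν U (𝓝 μ) := hμ
  have hinv : μ ∈ invariantMeasures f := by
    refine mem_invariantMeasures_of_integral_eq hf fun g => ?_
    have h1 := ((tendsto_integral hμ (g.comp ⟨f, hf⟩)).sub (tendsto_integral hμ g)).abs
    have h2 : Tendsto (fun n : ℕ => 2 * ‖g‖ / n) U (𝓝 0) :=
      (tendsto_const_div_atTop_nhds_zero_nat _).mono_left hU
    have h3 := le_of_tendsto_of_tendsto h1 h2 (hUG.mono fun n hn => hν1 n hn g)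
    exact sub_eq_zero.1 (abs_nonpos_iff.1 h3)
  refine ⟨μ, hinv, ?_⟩
  obtain ⟨k, ξ, hξ, hdiam, hfr⟩ := exists_partition_null_frontier (μ : Measure X) hε
  set r := ∫ x, φ x ∂(μ : Measure X)
  -- For fixed `q` the limit in `n` kills `q * log k / n`; only afterwards does `q` tend to
  -- infinity.
  have hq : ∀ q : ℕ, 0 < q → c - r ≤ partitionEntropy (μ : Measure X) (itinerary f ξ q) / q := by
    intro q hq
    have hfr' : ∀ a, (μ : Measure X) (frontier (itinerary f ξ q ⁻¹' {a})) = 0 := by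
      intro a
      have : itinerary f ξ q ⁻¹' {a} = ⋂ i : Fin q, f^[i] ⁻¹' (ξ ⁻¹' {a i}) := by
        ext x
        simp [itinerary, funext_iff]
      rw [this]
      refine measure_mono_null (frontier_iInter_subset_of_finite _)
        (measure_iUnion_null fun i => ?_)
      -- The frontier of a preimage lies in the preimage of the frontier, which is null by
      -- invariance of `μ`.
      refine measure_mono_null ((hf.iterate i).frontier_preimage_subset _) ?_
      rw [(MeasurePreserving.iterate hinv i).measure_preimage
        isClosed_frontier.measurableSet.nullMeasurableSet]
      exact hfr _
    have h1 := (((tendsto_partitionEntropy hμ hfr').div_const (q : ℝ)).add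
      ((tendsto_const_div_atTop_nhds_zero_nat (q * Real.log k)).mono_left hU)).add
      (tendsto_integral hμ φ)
    have h2 := ge_of_tendsto h1 (hUG.mono fun n hn => hν2 n hn k ξ hξ hdiam q hq)
    linarith
  have h1 : ENNReal.ofReal (c - r) ≤ entropyOfPartition f (μ : Measure X) ξ := by
    rw [entropyOfPartition, ← limsup_const (f := (atTop : Filter ℕ)) (ENNReal.ofReal (c - r))]
    exact limsup_le_limsup ((eventually_gt_atTop 0).mono fun q h =>
      ENNReal.ofReal_le_ofReal (hq q h))
  have h2 := h1.trans (entropyOfPartition_le_metricEntropy hf.measurable μ hξ)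
  calc (c : EReal) = ((c - r : ℝ) : EReal) + (r : EReal) := by
        rw [← EReal.coe_add]
        simp
    _ ≤ ((ENNReal.ofReal (c - r) : ℝ≥0∞) : EReal) + (r : EReal) := by
        refine add_le_add_left ?_ _
        rw [EReal.coe_ennreal_ofReal]
        exact EReal.coe_le_coe_iff.2 (le_max_left _ _)
    _ ≤ measurePressure f μ φ := add_le_add_left (EReal.coe_ennreal_le_coe_ennreal_iff.2 h2) _

end LowerBound

/-! ### Existence and stability of equilibrium states. -/

section Equilibrium

theorem IsUSC.coe_metricEntropy {X : Type*} [MetricSpace X] [MeasurableSpace X]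
    [BorelSpace X] {f : X → X} (husc : IsUSC f) :
    UpperSemicontinuousOn (fun μ => (metricEntropy f μ : EReal)) (invariantMeasures f) :=
  continuous_coe_ennreal_ereal.comp_upperSemicontinuousOn husc
    fun _ _ h => EReal.coe_ennreal_le_coe_ennreal_iff.2 h

variable {X : Type*} [MetricSpace X] [CompactSpace X]

/-- A single point is a separated set, and its Birkhoff sums are at least `-n * ‖φ‖`. This leaves a
real `c` below the pressure, from which an invariant measure is obtained. -/
theorem topPressure_ne_bot [Nonempty X] (f : X → X) (φ : C(X, ℝ)) : topPressure f φ ≠ ⊥ := by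
  intro h
  obtain ⟨x⟩ := ‹Nonempty X›
  have hc : topPressure f φ < ((-‖φ‖ - 1 : ℝ) : EReal) := h ▸ EReal.bot_lt_coe _
  obtain ⟨n, hn, hn1⟩ := ((eventually_log_sum_exp_le hc one_pos).and
    (eventually_gt_atTop 0)).exists
  have h1 := hn {x} (by simp [IsSeparatedSet]) (Finset.singleton_nonempty x)
  rw [Finset.sum_singleton, Real.log_exp] at h1
  have h2 : ∑ _k ∈ Finset.range n, -‖φ‖ ≤ birkhoffSum f φ n x :=
    Finset.sum_le_sum fun k _ => (abs_le.1 (φ.norm_coe_le_norm _)).1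
  rw [Finset.sum_const, Finset.card_range, nsmul_eq_mul] at h2
  have : (0 : ℝ) < n := by exact_mod_cast hn1
  linarith

variable [MeasurableSpace X] [BorelSpace X] {f : X → X}

theorem continuous_integral (g : C(X, ℝ)) :
    Continuous fun μ : ProbabilityMeasure X => ∫ x, g x ∂(μ : Measure X) :=
  continuous_iff_continuousAt.2 fun _ => tendsto_integral tendsto_id g

theorem isClosed_invariantMeasures (hf : Continuous f) : IsClosed (invariantMeasures f) := by
  have : invariantMeasures f = ⋂ g : C(X, ℝ), {μ : ProbabilityMeasure X |
      ∫ x, g (f x) ∂(μ : Measure X) = ∫ x, g x ∂(μ : Measure X)} := by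
    ext μ
    simp only [Set.mem_iInter, Set.mem_ofPred_eq]
    refine ⟨fun h g => ?_, fun h => mem_invariantMeasures_of_integral_eq hf h⟩
    have hμ : MeasurePreserving f (μ : Measure X) μ := h
    conv_rhs => rw [← hμ.map_eq]
    rw [integral_map hf.measurable.aemeasurable g.continuous.aestronglyMeasurable]
  rw [this]
  exact isClosed_iInter fun g =>
    isClosed_eq (continuous_integral (g.comp ⟨f, hf⟩)) (continuous_integral g)

/-- Addition in `EReal` is continuous where one summand is finite, so infinite entropies do no harm.
-/
theorem tendsto_ereal_add_coe {ι : Type*} {L : Filter ι} {u : ι → EReal} {a : EReal} {v : ι → ℝ}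
    {b : ℝ} (hu : Tendsto u L (𝓝 a)) (hv : Tendsto v L (𝓝 b)) :
    Tendsto (fun i => u i + (v i : EReal)) L (𝓝 (a + b)) :=
  (EReal.continuousAt_add (p := (a, (b : EReal))) (Or.inr (EReal.coe_ne_bot b))
    (Or.inr (EReal.coe_ne_top b))).tendsto.comp
      (hu.prodMk_nhds ((continuous_coe_real_ereal.tendsto b).comp hv))

theorem upperSemicontinuousOn_measurePressure (husc : IsUSC f) (φ : C(X, ℝ)) :
    UpperSemicontinuousOn (fun μ => measurePressure f μ φ) (invariantMeasures f) := by
  have h2 : Continuous fun μ : ProbabilityMeasure X =>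
      ((∫ x, φ x ∂(μ : Measure X) : ℝ) : EReal) :=
    continuous_coe_real_ereal.comp (continuous_integral φ)
  exact husc.coe_metricEntropy.add' (h2.upperSemicontinuous.upperSemicontinuousOn _) fun μ _ =>
    EReal.continuousAt_add (Or.inr (EReal.coe_ne_bot _)) (Or.inr (EReal.coe_ne_top _))

/-- Upper semi-continuity of the entropy gives the existence of equilibrium states. -/
theorem equilibriumStates_nonempty [Nonempty X] (hf : Continuous f) (husc : IsUSC f)
    (φ : C(X, ℝ)) : (equilibriumStates f φ).Nonempty := by
  have hne : (invariantMeasures f).Nonempty := by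
    obtain ⟨c, -, hc⟩ := EReal.lt_iff_exists_real_btwn.1 (topPressure_ne_bot f φ).bot_lt
    obtain ⟨μ, hμ, -⟩ := exists_le_measurePressure hf hc
    exact ⟨μ, hμ⟩
  obtain ⟨μ, hμ, hmax⟩ := (upperSemicontinuousOn_measurePressure husc φ).exists_isMaxOn hne
    (isClosed_invariantMeasures hf).isCompact
  refine ⟨μ, hμ, le_antisymm (measurePressure_le_topPressure hf φ hμ) ?_⟩
  refine EReal.ge_of_forall_gt_iff_ge.1 fun c hc => ?_
  obtain ⟨ν, hν, hcν⟩ := exists_le_measurePressure hf hc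
  exact hcν.trans (hmax hν)

theorem tendsto_integral_of_tendsto {ι : Type*} {L : Filter ι} {ν : ι → ProbabilityMeasure X}
    {μ : ProbabilityMeasure X} (h : Tendsto ν L (𝓝 μ)) {φ : ι → C(X, ℝ)} {φ₀ : C(X, ℝ)}
    (hφ : Tendsto φ L (𝓝 φ₀)) :
    Tendsto (fun i => ∫ x, φ i x ∂(ν i : Measure X)) L (𝓝 (∫ x, φ₀ x ∂(μ : Measure X))) := by
  have h0 : Tendsto (fun i => ∫ x, φ i x ∂(ν i : Measure X) - ∫ x, φ₀ x ∂(ν i : Measure X)) L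
      (𝓝 0) := by
    refine squeeze_zero_norm (fun i => ?_) (tendsto_iff_norm_sub_tendsto_zero.1 hφ)
    rw [← integral_sub (continuousMap_integrable _ _) (continuousMap_integrable _ _)]
    have := norm_integral_le_of_norm_le_const (μ := (ν i : Measure X))
      (f := fun x => φ i x - φ₀ x) (C := ‖φ i - φ₀‖)
      (Eventually.of_forall fun x => (φ i - φ₀).norm_coe_le_norm x)
    simpa using this
  simpa using h0.add (tendsto_integral h φ₀)

/-- Limits of equilibrium states of converging potentials are equilibrium states, and the
entropies converge as well. -/
theorem exists_equilibriumState_tendsto [Nonempty X] (hf : Continuous f) (husc : IsUSC f)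
    {ι : Type*} (U : Ultrafilter ι) {φ : ι → C(X, ℝ)} {φ₀ : C(X, ℝ)} (hφ : Tendsto φ U (𝓝 φ₀))
    {ν : ι → ProbabilityMeasure X} (hν : ∀ i, ν i ∈ equilibriumStates f (φ i)) :
    ∃ μ ∈ equilibriumStates f φ₀, ∀ ψ : C(X, ℝ),
      Tendsto (fun i => measurePressure f (ν i) ψ) U (𝓝 (measurePressure f μ ψ)) := by
  obtain ⟨μ, hμ, hνμ⟩ := (isClosed_invariantMeasures hf).isCompact.ultrafilter_le_nhds (U.map ν)
    (le_principal_iff.2 (Eventually.of_forall fun i => (hν i).1 : ∀ᶠ i in (U : Filter ι), _))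
  replace hνμ : Tendsto ν U (𝓝 μ) := hνμ
  have hmax : ∀ i, ∀ ρ ∈ invariantMeasures f,
      measurePressure f ρ (φ i) ≤ measurePressure f (ν i) (φ i) := fun i ρ hρ =>
    (measurePressure_le_topPressure hf _ hρ).trans_eq (hν i).2.symm
  have hconst : ∀ ρ : ProbabilityMeasure X, Tendsto (fun i => ∫ x, φ i x ∂(ρ : Measure X)) U
      (𝓝 (∫ x, φ₀ x ∂(ρ : Measure X))) := fun ρ =>
    tendsto_integral_of_tendsto tendsto_const_nhds hφ
  have hint := tendsto_integral_of_tendsto hνμ hφ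
  have hent : Tendsto (fun i => (metricEntropy f (ν i) : EReal)) U (𝓝 (metricEntropy f μ)) := by
    refine tendsto_order.2 ⟨fun y hy => ?_, fun y hy => ?_⟩
    · have h1 := tendsto_ereal_add_coe (tendsto_const_nhds (x := (metricEntropy f μ : EReal)))
        ((hconst μ).sub hint)
      rw [sub_self, EReal.coe_zero, add_zero] at h1
      filter_upwards [h1.eventually_const_lt hy] with i hi
      refine hi.trans_le ?_
      have h2 := EReal.sub_le_sub (hmax i μ hμ)
        (le_refl ((∫ x, φ i x ∂(ν i : Measure X) : ℝ) : EReal))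
      rw [measurePressure, measurePressure, EReal.add_sub_cancel_right] at h2
      rwa [EReal.coe_sub, ← add_sub_assoc]
    -- Upper bound: semi-continuity of the entropy at `μ` within the invariant measures.
    · exact (tendsto_nhdsWithin_iff.2 ⟨hνμ, Eventually.of_forall fun i => (hν i).1⟩).eventually
        (husc.coe_metricEntropy μ hμ y hy)
  refine ⟨μ, ⟨hμ, ?_⟩, fun ψ => tendsto_ereal_add_coe hent (tendsto_integral hνμ ψ)⟩
  -- Maximality of `ν i` against an equilibrium state `ρ` of `φ₀` passes to the limit.
  obtain ⟨ρ, hρ⟩ := equilibriumStates_nonempty hf husc φ₀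
  refine le_antisymm (measurePressure_le_topPressure hf φ₀ hμ) ?_
  rw [← hρ.2]
  exact le_of_tendsto_of_tendsto (tendsto_ereal_add_coe tendsto_const_nhds (hconst ρ))
    (tendsto_ereal_add_coe hent hint) (Eventually.of_forall fun i => hmax i ρ hρ.1)

end Equilibrium

end Thermo

/-! ### The continuity theorem. -/

theorem mainTheorem4 {X : Type*} [MetricSpace X] [CompactSpace X] [MeasurableSpace X]
    [BorelSpace X] (f : X → X) (hf : Continuous f) (husc : Thermo.IsUSC f) :
    (∀ ψ : C(X, ℝ), Continuous (Thermo.commonPressure f ψ)) ∧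
      Continuous (fun φ : Thermo.uniqueEquilibriumSet f =>
        Thermo.metricEntropy f (Thermo.uniqueEquilibriumState f φ)) := by
  rcases isEmpty_or_nonempty X with hX | hX
  -- On the empty space there are no equilibrium states and the common value is arbitrary, but there
  -- is only one potential.
  · have : Subsingleton C(X, ℝ) := ⟨fun g h => ContinuousMap.ext fun x => hX.elim x⟩
    exact ⟨fun ψ => continuous_of_const fun a b => by rw [Subsingleton.elim a b],
      continuous_of_const fun a b => by rw [Subsingleton.elim a b]⟩
  constructor
  · intro ψ
    refine continuous_iff_ultrafilter.2 fun φ₀ U hU => ?_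
    choose ν hν using fun φ : Thermo.constPressureSet f ψ =>
      Thermo.equilibriumStates_nonempty hf husc φ
    obtain ⟨μ, hμ, h⟩ := Thermo.exists_equilibriumState_tendsto hf husc U
      (φ := fun φ => (φ : C(X, ℝ))) ((continuous_subtype_val.tendsto φ₀).mono_left hU) hν
    have h1 := h ψ
    rw [Thermo.measurePressure_eq_commonPressure f ψ φ₀ μ hμ] at h1
    exact h1.congr fun φ => Thermo.measurePressure_eq_commonPressure f ψ φ _ (hν φ)
  · refine continuous_iff_ultrafilter.2 fun φ₀ U hU => ?_
    obtain ⟨μ, hμ, h⟩ := Thermo.exists_equilibriumState_tendsto hf husc U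
      (φ := fun φ => (φ : C(X, ℝ))) ((continuous_subtype_val.tendsto φ₀).mono_left hU)
      (fun φ => (Thermo.mem_equilibriumStates_iff f φ _).2 rfl)
    -- The pressure of the zero potential is the entropy, seen in `EReal`; the embedding of `ℝ≥0∞`
    -- brings the limit back.
    have h1 := h 0
    rw [(Thermo.mem_equilibriumStates_iff f φ₀ μ).1 hμ] at h1
    simp only [Thermo.measurePressure, ContinuousMap.zero_apply, integral_zero, EReal.coe_zero,
      add_zero] at h1
    exact EReal.isEmbedding_coe_ennreal.tendsto_nhds_iff.2 h1
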